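/- Consider three parties, each with Hilbert space $\mathbb{C}^d$. Write an operator $\rho$ on $(\mathbb{C}^d)^{\otimes r}$ as $\rho=\sum \rho_{i_1i_2,\dots,i_{2r-1}i_{2r}}\,|i_1i_3\ldots i_{2r-1}\rangle\langle i_2i_4\ldots i_{2r}|$, and for $\sigma\in S_{2r}$ let $[\Lambda_\sigma(\rho)]_{i_1i_2,\dots,i_{2r-1}i_{2r}}=\rho_{i_{\sigma(1)}i_{\sigma(2)},\dots,i_{\sigma(2r-1)}i_{\sigma(2r)}}$. Let $\|A\|=\mathrm{Tr}\,(AA^\dagger)^{1/2}$ be the trace norm. The criterion $\sigma$ detects a state $\rho$ (positive semidefinite, trace one) if $\|\Lambda_\sigma(\rho)\|>1$. The criteria $\sigma$ and $\mu$ are dependent (for local dimension $d$) if $\|\Lambda_\sigma(\rho)\|=\|\Lambda_\mu(\rho)\|$ for all states $\rho$, and independent otherwise; a criterion is trivial if it is dependent with the identity permutation. The partial transpose $QT_k$ is the transposition $(2k-1,\,2k)$, and the realignment $R_{kl}$ is the transposition $(2k,\,2l-1)$. (1) Let $r=3$ and $d\ge 2$. Among the permutations in $S_6$ there are exactly $6$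 dependence classes other than the trivial one. They are represented by $QT_1,QT_2,QT_3,R_{12},R_{13},R_{23}$: each of these six is nontrivial, and every nontrivial $\sigma\in S_6$ is dependent with exactly one of them. Moreover, the six are truly independent: for any two distinct ones, there is a state detected by the first and not by the second. (2) For every $d\ge 2$ and every party $k$ there is a tripartite state that is not separable across the split of $k$ against the other two parties, is separable across each of the other two such splits, is detected by $QT_k$, and is not detected by $QT_j$ for $j\ne k$. (3) For every $d\ge 3$ and every pair $k<l$ there is a tripartite state all of whose three one-party partial transposes are positive semidefinite and which, among the six criteria, is detected by $R_{kl}$ and by no other. (4) Consider the following matrix, in the basis $|00\rangle,|01\rangle,|02\rangle,|10\rangle,\dots,|22\rangle$ of $\mathbb{C}^3\otimes\mathbb{C}^3$ (the chessboard state): $$\rho_c=\frac1{12}\begin{pmatrix}1&0&1&0&0&0&1&0&0\\0&1&0&0&0&-1&0&-1&0\\1&0&2&0&-1&0&0&0&0\\0&0&0&1&0&-1&0&1&0\\0&0&-1&0&1&0&1&0&0\\0&-1&0&-1&0&2&0&0&0\\1&0&0&0&1&0&2&0&0\\0&-1&0&1&0&0&0&2&0\\0&0&0&0&0&0&0&0&0\end{pmatrix}$$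 It is a state, both of its partial transposes are positive semidefinite, and $\|\Lambda_{R_{12}}(\rho_c)\|=7/6$. (5) Let $k<l$ be two of three parties and $m$ the third, all of local dimension $3$, and let $\alpha$ be any state on $\mathbb{C}^3$. Give the two parts of $\rho_c$ to $k$ and $l$ (in this order) and the uncorrelated ancilla $\alpha$ to $m$. The resulting operator is a state, its three one-party partial transposes are positive semidefinite, its trace norm after the realignment $R_{kl}$ is $7/6$, and among the six criteria it is detected by $R_{kl}$ and by no other. -/

import Mathlib

open scoped ComplexOrder

noncomputable section

namespace PermSep

/-- An operator on the `r`-fold tensor power of `ℂ^d`, as a matrix in the product basis: the row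
index is `(i₁, i₃, …, i_{2r-1})` and the column index is `(i₂, i₄, …, i_{2r})`. -/
abbrev Operator (r d : ℕ) : Type := Matrix (Fin r → Fin d) (Fin r → Fin d) ℂ

/-- Quantum states (density matrices): positive semidefinite matrices of trace one. -/
def IsState {n : Type*} [Fintype n] (ρ : Matrix n n ℂ) : Prop :=
  ρ.PosSemidef ∧ ρ.trace = 1

/-- The trace norm `Tr (A A†)^{1/2}`. -/
def traceNorm {n : Type*} [Fintype n] [DecidableEq n] (A : Matrix n n ℂ) : ℝ :=
  (cfc Real.sqrt (A * A.conjTranspose)).trace.re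

/-- The place `2k-1` (in one-based counting) among the `2r` indices: the row index of party `k`. -/
def rowPos {r : ℕ} (k : Fin r) : Fin (2 * r) := ⟨2 * k, by omega⟩

/-- The place `2k` (in one-based counting) among the `2r` indices: the column index of party `k`. -/
def colPos {r : ℕ} (k : Fin r) : Fin (2 * r) := ⟨2 * k + 1, by omega⟩

/-- The matrix entry `ρ_{i₁ i₂, i₃ i₄, …, i_{2r-1} i_{2r}}`. -/
def entry {r d : ℕ} (ρ : Operator r d) (i : Fin (2 * r) → Fin d) : ℂ :=
  ρ (fun k => i (rowPos k)) (fun k => i (colPos k))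

/-- The list of `2r` indices whose odd-numbered members form the row multi-index `a` and whose
even-numbered members form the column multi-index `b` (one-based counting). -/
def interleave {r d : ℕ} (a b : Fin r → Fin d) : Fin (2 * r) → Fin d := fun m =>
  if (m : ℕ) % 2 = 0 then a ⟨(m : ℕ) / 2, by omega⟩ else b ⟨(m : ℕ) / 2, by omega⟩

/-- The map `Λ_σ`, with
`[Λ_σ(ρ)]_{i₁ i₂, …, i_{2r-1} i_{2r}} = ρ_{i_{σ(1)} i_{σ(2)}, …, i_{σ(2r-1)} i_{σ(2r)}}`. -/
def permMap {r d : ℕ} (σ : Equiv.Perm (Fin (2 * r))) (ρ : Operator r d) : Operator r d :=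
  Matrix.of fun a b => entry ρ fun m => interleave a b (σ m)

/-- The criterion of `σ` detects `ρ` when `‖Λ_σ(ρ)‖ > 1`. -/
def Detects {r d : ℕ} (σ : Equiv.Perm (Fin (2 * r))) (ρ : Operator r d) : Prop :=
  1 < traceNorm (permMap σ ρ)

/-- Two permutations give dependent criteria (for local dimension `d`) when the two trace norms
agree on all quantum states. -/
def Dependent {r : ℕ} (d : ℕ) (σ μ : Equiv.Perm (Fin (2 * r))) : Prop :=
  ∀ ρ : Operator r d, IsState ρ → traceNorm (permMap σ ρ) = traceNorm (permMap μ ρ)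

/-- Dependence as an equivalence relation on `S_{2r}`. -/
def dependenceSetoid (r d : ℕ) : Setoid (Equiv.Perm (Fin (2 * r))) where
  r := Dependent d
  iseqv :=
    { refl := fun _ _ _ => rfl
      symm := fun h ρ hρ => (h ρ hρ).symm
      trans := fun h h' ρ hρ => (h ρ hρ).trans (h' ρ hρ) }

/-- The partial transpose of party `k`: the transposition `(2k-1, 2k)`. -/
def partialTranspose {r : ℕ} (k : Fin r) : Equiv.Perm (Fin (2 * r)) :=
  Equiv.swap (rowPos k) (colPos k)

/-- The realignment (reshuffling) `R_{kl}`: the transposition `(2k, 2l-1)`. -/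
def realignment {r : ℕ} (k l : Fin r) : Equiv.Perm (Fin (2 * r)) :=
  Equiv.swap (colPos k) (rowPos l)

/-- The three partial transposes and the three pairwise realignments for three parties. -/
def threePartyCriterion : Fin 6 → Equiv.Perm (Fin (2 * 3)) :=
  ![partialTranspose 0, partialTranspose 1, partialTranspose 2,
    realignment 0 1, realignment 0 2, realignment 1 2]

/-- `ρ` is separable across the split of party `k` against all the other parties: it is a finite
convex combination of products of a state of party `k` and a state of the other parties. -/
def SeparableAcross {r d : ℕ} (k : Fin r) (ρ : Operator r d) : Prop :=
  ∃ (n : ℕ) (p : Fin n → ℝ) (A : Fin n → Matrix (Fin d) (Fin d) ℂ)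
    (B : Fin n → Matrix ({j : Fin r // j ≠ k} → Fin d) ({j : Fin r // j ≠ k} → Fin d) ℂ),
    (∀ i, 0 < p i) ∧ ∑ i, p i = 1 ∧ (∀ i, IsState (A i)) ∧ (∀ i, IsState (B i)) ∧
    ∀ a b : Fin r → Fin d,
      ρ a b = ∑ i, (p i : ℂ) * (A i (a k) (b k) * B i (fun j => a j) (fun j => b j))

/-- The three-party operator in which parties `k` and `l` hold the two parts of `ω` and party `m`
holds the uncorrelated ancilla `α` (used for `k`, `l`, `m` distinct). -/
def withAncilla {d : ℕ} (k l m : Fin 3) (ω : Operator 2 d) (α : Matrix (Fin d) (Fin d) ℂ) :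
    Operator 3 d :=
  Matrix.of fun a b => ω ![a k, a l] ![b k, b l] * α (a m) (b m)

/-- Twelve times the chessboard state, in the ordered basis `|00⟩, |01⟩, |02⟩, |10⟩, …, |22⟩`. -/
def chessboardTable : Matrix (Fin 9) (Fin 9) ℂ :=
  !![1,  0,  1,  0,  0,  0, 1,  0, 0;
     0,  1,  0,  0,  0, -1, 0, -1, 0;
     1,  0,  2,  0, -1,  0, 0,  0, 0;
     0,  0,  0,  1,  0, -1, 0,  1, 0;
     0,  0, -1,  0,  1,  0, 1,  0, 0;
     0, -1,  0, -1,  0,  2, 0,  0, 0;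
     1,  0,  0,  0,  1,  0, 2,  0, 0;
     0, -1,  0,  1,  0,  0, 0,  2, 0;
     0,  0,  0,  0,  0,  0, 0,  0, 0]

/-- The chessboard state of two parties with local dimension three; `finProdFinEquiv` sends the
pair `(x, y)` to `3 x + y`. -/
def chessboard : Operator 2 3 :=
  Matrix.of fun a b =>
    (1 / 12 : ℂ) *
      chessboardTable (finProdFinEquiv (a 0, a 1)) (finProdFinEquiv (b 0, b 1))

end PermSep

end

/-! Upper bound on the classes. Left multiplication by a permutation that preserves the row places
and the column places only reindexes rows and columns, so `‖Λ_σ(ρ)‖` depends only on which places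
`σ` sends to row places (`traceNorm_permMap_congr`). For three parties these are the 20
three-element subsets of six places. Left multiplication by the full transposition transposes
`Λ_σ(ρ)`. Right multiplication conjugates it, because `ρ` is Hermitian. Neither changes the norm.
The resulting action on the 20 subsets has seven orbits: the trivial one, three of size two (partial
transposes) and three of size four (realignments). The finite check is
`exists_representative_pattern`.

Separation of the classes. A two-party state `ω` held by `k` and `l` is tensored with an ancilla `α`
at `m`. Criteria on `k` and `l` alone see only `ω`, and the partial transpose of `m` sees nothing. A
realignment between `m` and `k` or `l` factors as a rectangular matrix `M` built from `ω`, tensored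
with `α` read as a single row or column. If both partial traces of `ω²` equal `c • 1`, then `M` is
`√c` times an isometry or a coisometry, and the norm is `d √c ‖α‖₂`
(`traceNorm_of_isAncillaRealignment`). For the Bell state this is the square root of twice the
purity of `α`, so a mixed and a pure ancilla together separate all pairs of criteria
(`exists_detects_not_detects`). For the chessboard state it is at most `√3 / 2`, while the partial
transposes remain positive and `R_{kl}` gives `7/6` (`chessboard_withAncilla_detects`).

Entanglement across one split comes from a GHZ state mixed with four basis states
(`exists_entangled_across_one_split`). Higher dimensions follow by extension by zero, which commutes
with every `Λ_σ` and preserves trace norms. Concrete norms and positivity are certified by integral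
matrix identities. -/

namespace PermSep

open scoped MatrixOrder Kronecker
open Matrix

/-! ### Trace norms of rectangular matrices -/

section TraceNorm

variable {m n m' n' : Type*} [Fintype m] [DecidableEq m] [Fintype n]
  [Fintype m'] [DecidableEq m'] [Fintype n']

/-- The trace norm of a rectangular matrix. -/
noncomputable def rectTraceNorm (A : Matrix m n ℂ) : ℝ :=
  (cfc Real.sqrt (A * Aᴴ)).trace.re

lemma traceNorm_eq_rectTraceNorm (A : Matrix m m ℂ) : traceNorm A = rectTraceNorm A := rfl

lemma cfc_sqrt_eq_sqrt {A : Matrix m m ℂ} (hA : A.PosSemidef) :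
    cfc Real.sqrt A = CFC.sqrt A := by
  rw [CFC.sqrt_eq_real_sqrt A hA.nonneg, cfcₙ_eq_cfc]

/-- The trace norm is the trace of any positive semidefinite square root of `A A†`. -/
lemma rectTraceNorm_eq {A : Matrix m n ℂ} {P : Matrix m m ℂ} (hP : P.PosSemidef)
    (h : P * P = A * Aᴴ) : rectTraceNorm A = P.trace.re := by
  rw [rectTraceNorm, cfc_sqrt_eq_sqrt (posSemidef_self_mul_conjTranspose A),
    CFC.sqrt_unique h hP.nonneg]

/-- Supplies a root to transport: each invariance below exhibits the transported root and applies
`rectTraceNorm_eq`. -/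
lemma exists_sqrt (A : Matrix m n ℂ) :
    ∃ P : Matrix m m ℂ, P.PosSemidef ∧ P * P = A * Aᴴ ∧ P.trace = (rectTraceNorm A : ℂ) := by
  have hA := posSemidef_self_mul_conjTranspose A
  have hP : (CFC.sqrt (A * Aᴴ)).PosSemidef := (CFC.sqrt_nonneg _).posSemidef
  have h := CFC.sqrt_mul_sqrt_self (A * Aᴴ) hA.nonneg
  refine ⟨_, hP, h, ?_⟩
  rw [rectTraceNorm_eq hP h]
  exact Complex.eq_re_of_ofReal_le (r := 0) (by rw [Complex.ofReal_zero]; exact hP.trace_nonneg)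

lemma rectTraceNorm_eq_of_posSemidef {A : Matrix m m ℂ} (hA : A.PosSemidef) :
    rectTraceNorm A = A.trace.re :=
  rectTraceNorm_eq hA (by rw [hA.isHermitian.eq])

lemma IsState.rectTraceNorm_eq_one {A : Matrix m m ℂ} (hA : IsState A) : rectTraceNorm A = 1 := by
  rw [rectTraceNorm_eq_of_posSemidef hA.1, hA.2, Complex.one_re]

lemma rectTraceNorm_submatrix (A : Matrix m n ℂ) (e : m' ≃ m) (f : n' ≃ n) :
    rectTraceNorm (A.submatrix e f) = rectTraceNorm A := by
  obtain ⟨P, hP, h, ht⟩ := exists_sqrt A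
  rw [rectTraceNorm_eq (hP.submatrix e), ← Complex.ofReal_re (rectTraceNorm A), ← ht]
  · simp only [trace, diag_apply, submatrix_apply]
    rw [Equiv.sum_comp e fun i => P i i]
  · rw [submatrix_mul_equiv, h, conjTranspose_submatrix, submatrix_mul_equiv]

lemma rectTraceNorm_map_conj (A : Matrix m n ℂ) :
    rectTraceNorm (A.map (starRingEnd ℂ)) = rectTraceNorm A := by
  obtain ⟨P, hP, h, ht⟩ := exists_sqrt A
  have hP' : P.map (starRingEnd ℂ) = Pᵀ := by
    conv_rhs => rw [← hP.isHermitian.eq]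
    ext; simp [conjTranspose_apply]
  rw [rectTraceNorm_eq (P := P.map (starRingEnd ℂ)) (by rw [hP']; exact hP.transpose),
    ← Complex.ofReal_re (rectTraceNorm A), ← ht, hP', trace_transpose]
  rw [← Matrix.map_mul, h, Matrix.map_mul]
  congr 1

lemma rectTraceNorm_kronecker (A : Matrix m n ℂ) (B : Matrix m' n' ℂ) :
    rectTraceNorm (A ⊗ₖ B) = rectTraceNorm A * rectTraceNorm B := by
  obtain ⟨P, hP, h, ht⟩ := exists_sqrt A
  obtain ⟨Q, hQ, h', ht'⟩ := exists_sqrt B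
  rw [rectTraceNorm_eq (hP.kronecker hQ), trace_kronecker, ht, ht']
  · rw [← Complex.ofReal_mul, Complex.ofReal_re]
  · rw [← mul_kronecker_mul, h, h', conjTranspose_kronecker, mul_kronecker_mul]

/-- If `P` is the root for `A`, then `V P V†` is the root for `V A W†`: the inner factors `V†V` and
`W†W` cancel. -/
lemma rectTraceNorm_isometry [DecidableEq n] {A : Matrix m n ℂ} {V : Matrix m' m ℂ} {W : Matrix n' n ℂ}
    (hV : Vᴴ * V = 1) (hW : Wᴴ * W = 1) : rectTraceNorm (V * A * Wᴴ) = rectTraceNorm A := by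
  obtain ⟨P, hP, h, ht⟩ := exists_sqrt A
  rw [rectTraceNorm_eq (hP.mul_mul_conjTranspose_same V), trace_mul_comm, ← Matrix.mul_assoc, hV,
    Matrix.one_mul, ht, Complex.ofReal_re]
  calc V * P * Vᴴ * (V * P * Vᴴ) = V * P * (Vᴴ * V) * P * Vᴴ := by simp only [Matrix.mul_assoc]
    _ = V * (P * P) * Vᴴ := by rw [hV]; simp only [Matrix.mul_assoc, Matrix.one_mul]
    _ = V * A * (Wᴴ * W) * Aᴴ * Vᴴ := by rw [h, hW]; simp only [Matrix.mul_assoc, Matrix.one_mul]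
    _ = V * A * Wᴴ * (V * A * Wᴴ)ᴴ := by
      simp only [conjTranspose_mul, conjTranspose_conjTranspose, Matrix.mul_assoc]

lemma rectTraceNorm_eq_of_mul_conjTranspose {A : Matrix m n ℂ} {c : ℝ} (hc : 0 ≤ c)
    (h : A * Aᴴ = (c : ℂ) • 1) : rectTraceNorm A = Fintype.card m * √c := by
  have hP : (((√c : ℝ) : ℂ) • (1 : Matrix m m ℂ)).PosSemidef :=
    PosSemidef.one.smul (by simp [Real.sqrt_nonneg])
  rw [rectTraceNorm_eq hP]
  · simp [mul_comm]
  · rw [h, smul_mul_smul, Matrix.one_mul, ← Complex.ofReal_mul, Real.mul_self_sqrt hc]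

/-- Here `(A A†)² = c A A†`, so `A A† / √c` is the positive root; the case `c = 0` forces `A = 0`.
-/
lemma rectTraceNorm_eq_of_conjTranspose_mul [DecidableEq n] {A : Matrix m n ℂ} {c : ℝ} (hc : 0 ≤ c)
    (h : Aᴴ * A = (c : ℂ) • 1) : rectTraceNorm A = Fintype.card n * √c := by
  rcases hc.eq_or_lt with rfl | hc
  · have hA : A = 0 := by simpa using h
    rw [rectTraceNorm_eq (P := 0) PosSemidef.zero (by simp [hA])]
    simp
  have hs : ((√c : ℝ) : ℂ) * ((√c : ℝ) : ℂ) = c := by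
    rw [← Complex.ofReal_mul, Real.mul_self_sqrt hc.le]
  have hs0 : ((√c : ℝ) : ℂ) ≠ 0 := by simpa using (Real.sqrt_pos.2 hc).ne'
  have hP : ((((√c)⁻¹ : ℝ) : ℂ) • (A * Aᴴ)).PosSemidef :=
    (posSemidef_self_mul_conjTranspose A).smul (by simp [Real.sqrt_nonneg])
  rw [rectTraceNorm_eq hP]
  · rw [trace_smul, trace_mul_comm, h, trace_smul, trace_one, smul_eq_mul, smul_eq_mul,
      ← hs, Complex.ofReal_inv, mul_assoc, inv_mul_cancel_left₀ hs0]
    simp [mul_comm]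
  · rw [smul_mul_smul, ← Matrix.mul_assoc, Matrix.mul_assoc A Aᴴ A, h, Matrix.mul_smul,
      Matrix.smul_mul, smul_smul, ← hs, Matrix.mul_one, Complex.ofReal_inv]
    field_simp
    simp

lemma rectTraceNorm_row [Unique m] (A : Matrix m n ℂ) :
    rectTraceNorm A = √(∑ j, ‖A default j‖ ^ 2) := by
  have h0 : 0 ≤ ∑ j, ‖A default j‖ ^ 2 := by positivity
  rw [rectTraceNorm_eq_of_mul_conjTranspose h0]
  · simp
  · ext i j
    rw [Unique.eq_default i, Unique.eq_default j]
    simp [mul_apply, Complex.mul_conj, Complex.normSq_eq_norm_sq]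

lemma rectTraceNorm_col [Unique n] (A : Matrix m n ℂ) :
    rectTraceNorm A = √(∑ j, ‖A j default‖ ^ 2) := by
  have h0 : 0 ≤ ∑ j, ‖A j default‖ ^ 2 := by positivity
  rw [rectTraceNorm_eq_of_conjTranspose_mul h0]
  · simp
  · ext i j
    rw [Unique.eq_default i, Unique.eq_default j]
    simp [mul_apply, Complex.conj_mul']

lemma charpoly_sqrt_trace {A : Matrix m m ℂ} (hA : A.PosSemidef) :
    (cfc Real.sqrt A).trace = (A.charpoly.roots.map fun z => ((√z.re : ℝ) : ℂ)).sum := by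
  rw [hA.isHermitian.cfc_eq, hA.isHermitian.roots_charpoly_eq_eigenvalues, IsHermitian.cfc,
    Unitary.conjStarAlgAut_apply, trace_mul_comm, ← Matrix.mul_assoc]
  simp [trace]

/-- The trace of the root depends only on the characteristic polynomial, which `A A†` and `A† A`
share. -/
lemma traceNorm_conjTranspose (A : Matrix m m ℂ) : traceNorm Aᴴ = traceNorm A := by
  rw [traceNorm, traceNorm, charpoly_sqrt_trace (posSemidef_self_mul_conjTranspose A),
    charpoly_sqrt_trace (posSemidef_self_mul_conjTranspose Aᴴ), conjTranspose_conjTranspose,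
    charpoly_mul_comm]

lemma traceNorm_transpose (A : Matrix m m ℂ) : traceNorm Aᵀ = traceNorm A := by
  rw [← traceNorm_conjTranspose A, traceNorm_eq_rectTraceNorm, ← rectTraceNorm_map_conj]
  rfl

/-- The purity of a state is at most one. -/
lemma IsState.sum_norm_sq_le_one {A : Matrix m m ℂ} (hA : IsState A) :
    ∑ p : m × m, ‖A p.1 p.2‖ ^ 2 ≤ 1 := by
  have hH := hA.1.isHermitian
  have h1 : ((∑ p : m × m, ‖A p.1 p.2‖ ^ 2 : ℝ) : ℂ) = (A * A).trace := by
    conv_rhs => rw [← hH.eq]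
    conv_rhs => enter [1, 1]; rw [hH.eq]
    simp [trace, mul_apply, Fintype.sum_prod_type, Complex.mul_conj']
  have h2 : (A * A).trace = ((∑ i, hH.eigenvalues i ^ 2 : ℝ) : ℂ) := by
    conv_lhs => rw [hH.spectral_theorem]
    rw [← map_mul, Unitary.conjStarAlgAut_apply, trace_mul_comm, ← Matrix.mul_assoc]
    simp [trace, sq]
  have h3 : ∑ i, hH.eigenvalues i = 1 := by
    have := hH.trace_eq_sum_eigenvalues
    rw [hA.2] at this
    apply Complex.ofReal_injective
    rw [Complex.ofReal_sum, Complex.ofReal_one]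
    exact this.symm
  rw [h2] at h1
  rw [Complex.ofReal_injective h1, ← one_pow 2, ← h3]
  -- The purity is the sum of the squared eigenvalues, which are nonnegative with sum one.
  exact Finset.sum_sq_le_sq_sum_of_nonneg fun i _ => hA.1.eigenvalues_nonneg i

end TraceNorm

/-! ### Extension by zero along an injection of basis labels -/

section Embedding

set_option linter.unusedSectionVars false

variable {m n : Type*} [Fintype m] [DecidableEq m] [Fintype n] [DecidableEq n]

/-- The isometry `|i⟩ ↦ |ι i⟩` attached to a map `ι` of basis labels. -/
def labelIsometry (ι : m → n) : Matrix n m ℂ := Matrix.of fun i j => if i = ι j then 1 else 0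

/-- The extension by zero of an operator along a map `ι` of basis labels. -/
def extend (ι : m → n) (A : Matrix m m ℂ) : Matrix n n ℂ :=
  labelIsometry ι * A * (labelIsometry ι)ᴴ

variable {ι : m → n}

lemma labelIsometry_isometry (hι : Function.Injective ι) :
    (labelIsometry ι)ᴴ * labelIsometry ι = 1 := by
  ext i j
  simp [labelIsometry, mul_apply, one_apply, hι.eq_iff, eq_comm]

lemma extend_apply (hι : Function.Injective ι) (A : Matrix m m ℂ) (i j : m) :
    extend ι A (ι i) (ι j) = A i j := by
  simp [extend, labelIsometry, mul_apply, hι.eq_iff]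

lemma extend_apply_of_left (A : Matrix m m ℂ) {i : n} (hi : i ∉ Set.range ι) (j : n) :
    extend ι A i j = 0 := by
  have : ∀ k, i ≠ ι k := fun k h => hi ⟨k, h.symm⟩
  simp [extend, labelIsometry, mul_apply, this]

lemma extend_apply_of_right (A : Matrix m m ℂ) (i : n) {j : n} (hj : j ∉ Set.range ι) :
    extend ι A i j = 0 := by
  have : ∀ k, j ≠ ι k := fun k h => hj ⟨k, h.symm⟩
  simp [extend, labelIsometry, mul_apply, this]

lemma posSemidef_extend {A : Matrix m m ℂ} (hA : A.PosSemidef) : (extend ι A).PosSemidef :=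
  hA.mul_mul_conjTranspose_same _

lemma IsState.extend (hι : Function.Injective ι) {A : Matrix m m ℂ} (hA : IsState A) :
    IsState (extend ι A) := by
  refine ⟨posSemidef_extend hA.1, ?_⟩
  rw [PermSep.extend, trace_mul_comm, ← Matrix.mul_assoc, labelIsometry_isometry hι, Matrix.one_mul,
    hA.2]

lemma traceNorm_extend (hι : Function.Injective ι) (A : Matrix m m ℂ) :
    traceNorm (extend ι A) = traceNorm A :=
  rectTraceNorm_isometry (labelIsometry_isometry hι) (labelIsometry_isometry hι)

end Embedding

/-! ### The action of permutations and its norm-preserving symmetries -/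

section PermMap

variable {r d : ℕ}

lemma rowPos_injective : Function.Injective (rowPos (r := r)) := fun a b h => by
  simp [rowPos, Fin.ext_iff] at h; exact Fin.ext h

lemma colPos_injective : Function.Injective (colPos (r := r)) := fun a b h => by
  simp [colPos, Fin.ext_iff] at h; exact Fin.ext h

lemma rowPos_ne_colPos (k l : Fin r) : rowPos k ≠ colPos l := by
  simp only [rowPos, colPos, ne_eq, Fin.mk.injEq]; omega

@[simp] lemma rowPos_inj {k l : Fin r} : rowPos k = rowPos l ↔ k = l := rowPos_injective.eq_iff
@[simp] lemma colPos_inj {k l : Fin r} : colPos k = colPos l ↔ k = l := colPos_injective.eq_iff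

lemma rowPos_or_colPos (m : Fin (2 * r)) : (∃ k, m = rowPos k) ∨ ∃ k, m = colPos k := by
  rcases Nat.mod_two_eq_zero_or_one m with h | h
  · exact Or.inl ⟨⟨m / 2, by omega⟩, Fin.ext (by simp only [rowPos]; omega)⟩
  · exact Or.inr ⟨⟨m / 2, by omega⟩, Fin.ext (by simp only [colPos]; omega)⟩

@[simp] lemma interleave_rowPos (a b : Fin r → Fin d) (k : Fin r) :
    interleave a b (rowPos k) = a k := by
  simp [interleave, rowPos]

@[simp] lemma interleave_colPos (a b : Fin r → Fin d) (k : Fin r) :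
    interleave a b (colPos k) = b k := by
  rw [interleave, if_neg (by simp only [colPos]; omega)]
  congr 1
  exact Fin.ext (by simp only [colPos]; omega)

lemma interleave_eta (i : Fin (2 * r) → Fin d) :
    interleave (fun k => i (rowPos k)) (fun k => i (colPos k)) = i := by
  funext m
  rcases rowPos_or_colPos m with ⟨k, rfl⟩ | ⟨k, rfl⟩ <;> simp

lemma permMap_apply (σ : Equiv.Perm (Fin (2 * r))) (ρ : Operator r d) (a b : Fin r → Fin d) :
    permMap σ ρ a b = ρ (fun k => interleave a b (σ (rowPos k)))
      (fun k => interleave a b (σ (colPos k))) := rfl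

lemma permMap_one (ρ : Operator r d) : permMap 1 ρ = ρ := by
  ext a b; simp [permMap_apply]

/-- The order matters below: the right factor acts on the state itself, the left factor on the
matrix already permuted. -/
lemma permMap_mul (σ τ : Equiv.Perm (Fin (2 * r))) (ρ : Operator r d) :
    permMap (σ * τ) ρ = permMap σ (permMap τ ρ) := by
  ext a b
  simp only [permMap_apply, Equiv.Perm.mul_apply]
  rw [interleave_eta fun m => interleave a b (σ m)]

lemma permMap_map_conj (σ : Equiv.Perm (Fin (2 * r))) (ρ : Operator r d) :
    permMap σ (ρ.map (starRingEnd ℂ)) = (permMap σ ρ).map (starRingEnd ℂ) := rfl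

lemma permMap_partialTranspose_apply (j : Fin r) (ρ : Operator r d) (a b : Fin r → Fin d) :
    permMap (partialTranspose j) ρ a b
      = ρ (Function.update a j (b j)) (Function.update b j (a j)) := by
  rw [permMap_apply]
  congr 1 <;> funext k <;> by_cases h : k = j
  · subst h; simp [partialTranspose]
  · rw [partialTranspose, Equiv.swap_apply_of_ne_of_ne (by simpa) (rowPos_ne_colPos _ _)]
    simp [h]
  · subst h; simp [partialTranspose]
  · rw [partialTranspose, Equiv.swap_apply_of_ne_of_ne (rowPos_ne_colPos _ _).symm (by simpa)]
    simp [h]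

lemma permMap_realignment_apply (x y : Fin r) (ρ : Operator r d) (a b : Fin r → Fin d) :
    permMap (realignment x y) ρ a b
      = ρ (Function.update a y (b x)) (Function.update b x (a y)) := by
  rw [permMap_apply]
  congr 1 <;> funext k
  · by_cases h : k = y
    · subst h; simp [realignment]
    · rw [realignment, Equiv.swap_apply_of_ne_of_ne (rowPos_ne_colPos _ _) (by simpa)]
      simp [h]
  · by_cases h : k = x
    · subst h; simp [realignment]
    · rw [realignment, Equiv.swap_apply_of_ne_of_ne (by simpa) (rowPos_ne_colPos _ _).symm]
      simp [h]

/-- The permutation exchanging row and column indices of every party. -/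
def fullTranspose (r : ℕ) : Equiv.Perm (Fin (2 * r)) :=
  Function.Involutive.toPerm
    (fun m => if h : (m : ℕ) % 2 = 0 then ⟨m + 1, by omega⟩ else ⟨m - 1, by omega⟩)
    (fun m => by
      rcases Nat.mod_two_eq_zero_or_one m with h | h
      · have h' : ¬ ((m : ℕ) + 1) % 2 = 0 := by omega
        simp [h, h']
      · have h0 : ¬ (m : ℕ) % 2 = 0 := by omega
        have h' : ((m : ℕ) - 1) % 2 = 0 := by omega
        simp only [h0, dite_false, h', dite_true]
        exact Fin.ext (by simp only; omega))

@[simp] lemma fullTranspose_rowPos (k : Fin r) : fullTranspose r (rowPos k) = colPos k := by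
  simp [fullTranspose, rowPos, colPos, Function.Involutive.toPerm]

@[simp] lemma fullTranspose_colPos (k : Fin r) : fullTranspose r (colPos k) = rowPos k := by
  simp [fullTranspose, rowPos, colPos, Function.Involutive.toPerm]

lemma permMap_fullTranspose (ρ : Operator r d) : permMap (fullTranspose r) ρ = ρᵀ := by
  ext a b; simp [permMap_apply]

/-- The transpose of a Hermitian matrix is its entrywise conjugate, and conjugation commutes with
every permutation of indices. -/
lemma traceNorm_permMap_mul_fullTranspose {ρ : Operator r d} (hρ : ρ.IsHermitian)
    (σ : Equiv.Perm (Fin (2 * r))) :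
    traceNorm (permMap (σ * fullTranspose r) ρ) = traceNorm (permMap σ ρ) := by
  have h : ρᵀ = ρ.map (starRingEnd ℂ) := by
    conv_lhs => rw [← hρ.eq]
    rfl
  rw [permMap_mul, permMap_fullTranspose, h, permMap_map_conj]
  exact rectTraceNorm_map_conj _

lemma traceNorm_permMap_fullTranspose_mul (ρ : Operator r d) (σ : Equiv.Perm (Fin (2 * r))) :
    traceNorm (permMap (fullTranspose r * σ) ρ) = traceNorm (permMap σ ρ) := by
  rw [permMap_mul, permMap_fullTranspose, traceNorm_transpose]

/-- A permutation preserving the sets of row and of column places does not change the trace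
norm. -/
lemma traceNorm_permMap_of_forall_mod_two {π : Equiv.Perm (Fin (2 * r))}
    (hπ : ∀ m, (π m : ℕ) % 2 = (m : ℕ) % 2) (ρ : Operator r d) :
    traceNorm (permMap π ρ) = traceNorm ρ := by
  have hrow : ∀ k, ∃ l, π (rowPos k) = rowPos l := fun k => by
    rcases rowPos_or_colPos (π (rowPos k)) with h | ⟨l, hl⟩
    · exact h
    · have := hπ (rowPos k); rw [hl] at this; simp only [colPos, rowPos] at this; omega
  have hcol : ∀ k, ∃ l, π (colPos k) = colPos l := fun k => by
    rcases rowPos_or_colPos (π (colPos k)) with ⟨l, hl⟩ | h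
    · have := hπ (colPos k); rw [hl] at this; simp only [colPos, rowPos] at this; omega
    · exact h
  choose f hf using hrow
  choose g hg using hcol
  have hfi : Function.Injective f := fun k l h => by
    apply rowPos_injective; apply π.injective; rw [hf, hf, h]
  have hgi : Function.Injective g := fun k l h => by
    apply colPos_injective; apply π.injective; rw [hg, hg, h]
  let e := Equiv.ofBijective f (Finite.injective_iff_bijective.1 hfi)
  let e' := Equiv.ofBijective g (Finite.injective_iff_bijective.1 hgi)
  have h : permMap π ρ = ρ.submatrix (e.symm.arrowCongr (Equiv.refl (Fin d)))
      (e'.symm.arrowCongr (Equiv.refl (Fin d))) := by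
    ext a b
    simp only [permMap_apply, hf, hg, interleave_rowPos, interleave_colPos]
    rfl
  rw [h]
  exact rectTraceNorm_submatrix _ _ _

/-- The quotient `σ * μ⁻¹` preserves parity of places and acts last, as a mere relabelling of rows
and columns. -/
lemma traceNorm_permMap_congr {σ μ : Equiv.Perm (Fin (2 * r))}
    (h : ∀ m, (σ m : ℕ) % 2 = (μ m : ℕ) % 2) (ρ : Operator r d) :
    traceNorm (permMap σ ρ) = traceNorm (permMap μ ρ) := by
  have : σ = (σ * μ⁻¹) * μ := by group
  rw [this, permMap_mul]
  exact traceNorm_permMap_of_forall_mod_two (fun m => by simp [h]) _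

end PermMap

/-! ### At most seven classes for three parties -/

section Classification

/-- The trivial criterion followed by the six nontrivial ones. -/
def representative : Option (Fin 6) → Equiv.Perm (Fin (2 * 3))
  | none => 1
  | some c => threePartyCriterion c

set_option maxRecDepth 100000 in
-- The pattern `p` marks the places sent to row places. The flag `i` complements this set, and `j`
-- exchanges the two places of every party.
lemma exists_representative_pattern : ∀ p : Fin (2 * 3) → Bool,
    (Finset.univ.filter fun m => p m = true).card = 3 →
    ∃ (c : Option (Fin 6)) (i j : Bool), ∀ m : Fin (2 * 3),
      p m = decide ((((cond i (fullTranspose 3) 1) * representative c *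
        (cond j (fullTranspose 3) 1)) m : ℕ) % 2 = 0) := by
  decide +kernel

lemma exists_dependent_representative (d : ℕ) (σ : Equiv.Perm (Fin (2 * 3))) :
    ∃ c, Dependent d σ (representative c) := by
  obtain ⟨c, i, j, h⟩ := exists_representative_pattern (fun m => decide ((σ m : ℕ) % 2 = 0)) (by
    have : (Finset.univ.filter fun m => decide ((σ m : ℕ) % 2 = 0) = true)
        = (Finset.univ.filter fun m : Fin (2 * 3) => (m : ℕ) % 2 = 0).map σ.symm.toEmbedding := by
      ext m; simp [Finset.mem_map_equiv]
    rw [this, Finset.card_map]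
    decide)
  refine ⟨c, fun ρ hρ => ?_⟩
  rw [traceNorm_permMap_congr (μ := cond i (fullTranspose 3) 1 * representative c *
    cond j (fullTranspose 3) 1)]
  · cases i <;> cases j <;> simp only [cond_true, cond_false, one_mul, mul_one, mul_assoc,
      traceNorm_permMap_fullTranspose_mul, traceNorm_permMap_mul_fullTranspose hρ.1.isHermitian]
  · intro m
    have := h m
    simp only [decide_eq_decide] at this
    omega

end Classification

/-! ### Raising the local dimension -/

section ExtendOperator

variable {r d₀ d : ℕ}

/-- The inclusion of product basis labels of local dimension `d₀` into those of local
dimension `d`. -/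
def labelInclusion (α : Type*) (h : d₀ ≤ d) (a : α → Fin d₀) : α → Fin d :=
  fun k => Fin.castLE h (a k)

lemma labelInclusion_injective (α : Type*) (h : d₀ ≤ d) :
    Function.Injective (labelInclusion α h) := fun a b hab => by
  funext k
  exact Fin.castLE_injective h (congrFun hab k)

lemma mem_range_labelInclusion {α : Type*} (h : d₀ ≤ d) (a : α → Fin d) :
    a ∈ Set.range (labelInclusion α h) ↔ ∀ k, a k ∈ Set.range (Fin.castLE h) := by
  constructor
  · rintro ⟨b, rfl⟩ k
    exact ⟨b k, rfl⟩
  · intro H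
    choose b hb using H
    exact ⟨b, funext hb⟩

/-- An operator of local dimension `d₀`, extended by zero to local dimension `d`. -/
def extendOperator (h : d₀ ≤ d) (ρ : Operator r d₀) : Operator r d :=
  extend (labelInclusion (Fin r) h) ρ

lemma IsState.extendOperator (h : d₀ ≤ d) {ρ : Operator r d₀} (hρ : IsState ρ) :
    IsState (extendOperator h ρ) :=
  hρ.extend (labelInclusion_injective _ h)

lemma entry_extendOperator (h : d₀ ≤ d) (ρ : Operator r d₀) (i : Fin (2 * r) → Fin d₀) :
    entry (extendOperator h ρ) (labelInclusion _ h i) = entry ρ i :=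
  extend_apply (labelInclusion_injective _ h) ρ _ _

lemma entry_extendOperator_of_notMem (h : d₀ ≤ d) (ρ : Operator r d₀) {i : Fin (2 * r) → Fin d}
    (hi : i ∉ Set.range (labelInclusion _ h)) : entry (extendOperator h ρ) i = 0 := by
  rw [mem_range_labelInclusion] at hi
  push Not at hi
  obtain ⟨m, hm⟩ := hi
  rcases rowPos_or_colPos m with ⟨k, rfl⟩ | ⟨k, rfl⟩
  · refine extend_apply_of_left _ (fun H => hm ?_) _
    exact (mem_range_labelInclusion h _).1 H k
  · refine extend_apply_of_right _ _ (fun H => hm ?_)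
    exact (mem_range_labelInclusion h _).1 H k

lemma operator_ext {ρ ρ' : Operator r d} (h : ∀ i, entry ρ i = entry ρ' i) : ρ = ρ' := by
  ext a b
  simpa [entry] using h (interleave a b)

lemma entry_permMap (σ : Equiv.Perm (Fin (2 * r))) (ρ : Operator r d) (i : Fin (2 * r) → Fin d) :
    entry (permMap σ ρ) i = entry ρ fun m => i (σ m) := by
  rw [entry, permMap, of_apply, interleave_eta]

/-- An entry of the extension vanishes unless all `2r` indices lie in the small range, a condition
invariant under permuting the indices. -/
lemma permMap_extendOperator (h : d₀ ≤ d) (σ : Equiv.Perm (Fin (2 * r))) (ρ : Operator r d₀) :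
    permMap σ (extendOperator h ρ) = extendOperator h (permMap σ ρ) := by
  refine operator_ext fun i => ?_
  rw [entry_permMap]
  by_cases hi : i ∈ Set.range (labelInclusion _ h)
  · obtain ⟨i, rfl⟩ := hi
    rw [entry_extendOperator, entry_permMap]
    exact entry_extendOperator h ρ fun m => i (σ m)
  · rw [entry_extendOperator_of_notMem h _ hi, entry_extendOperator_of_notMem]
    rw [mem_range_labelInclusion] at hi ⊢
    exact fun H => hi fun k => by simpa using H (σ⁻¹ k)

lemma traceNorm_permMap_extendOperator (h : d₀ ≤ d) (σ : Equiv.Perm (Fin (2 * r)))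
    (ρ : Operator r d₀) :
    traceNorm (permMap σ (extendOperator h ρ)) = traceNorm (permMap σ ρ) := by
  rw [permMap_extendOperator]
  exact traceNorm_extend (labelInclusion_injective _ h) _

lemma detects_extendOperator (h : d₀ ≤ d) (σ : Equiv.Perm (Fin (2 * r))) (ρ : Operator r d₀) :
    Detects σ (extendOperator h ρ) ↔ Detects σ ρ := by
  rw [Detects, Detects, traceNorm_permMap_extendOperator]

lemma SeparableAcross.extendOperator (h : d₀ ≤ d) {k : Fin r} {ρ : Operator r d₀}
    (hρ : SeparableAcross k ρ) : SeparableAcross k (extendOperator h ρ) := by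
  obtain ⟨n, p, A, B, hp, hp1, hA, hB, hρ⟩ := hρ
  refine ⟨n, p, fun i => extend (Fin.castLE h) (A i),
    fun i => extend (labelInclusion _ h) (B i), hp, hp1,
    fun i => (hA i).extend (Fin.castLE_injective h),
    fun i => (hB i).extend (labelInclusion_injective _ h), fun a b => ?_⟩
  by_cases ha : a ∈ Set.range (labelInclusion (Fin r) h)
  · by_cases hb : b ∈ Set.range (labelInclusion (Fin r) h)
    · obtain ⟨a₀, rfl⟩ := ha
      obtain ⟨b₀, rfl⟩ := hb
      rw [PermSep.extendOperator, extend_apply (labelInclusion_injective _ h), hρ]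
      refine Finset.sum_congr rfl fun i _ => ?_
      dsimp only
      rw [show labelInclusion (Fin r) h a₀ k = Fin.castLE h (a₀ k) from rfl,
        show labelInclusion (Fin r) h b₀ k = Fin.castLE h (b₀ k) from rfl,
        extend_apply (Fin.castLE_injective h)]
      congr 2
      exact (extend_apply (labelInclusion_injective {j : Fin r // j ≠ k} h) (B i)
        (fun j => a₀ j) (fun j => b₀ j)).symm
    · rw [PermSep.extendOperator, extend_apply_of_right _ _ hb, eq_comm]
      refine Finset.sum_eq_zero fun i _ => ?_
      dsimp only
      rw [mem_range_labelInclusion] at hb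
      push Not at hb
      obtain ⟨j, hj⟩ := hb
      by_cases hjk : j = k
      · subst hjk
        rw [extend_apply_of_right _ _ hj]; simp
      · rw [extend_apply_of_right (ι := labelInclusion {j : Fin r // j ≠ k} h) _ _ fun H =>
          hj ((mem_range_labelInclusion h _).1 H ⟨j, hjk⟩)]
        simp
  · rw [PermSep.extendOperator, extend_apply_of_left _ ha, eq_comm]
    refine Finset.sum_eq_zero fun i _ => ?_
    dsimp only
    rw [mem_range_labelInclusion] at ha
    push Not at ha
    obtain ⟨j, hj⟩ := ha
    by_cases hjk : j = k
    · subst hjk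
      rw [extend_apply_of_left _ hj]; simp
    · rw [extend_apply_of_left (ι := labelInclusion {j : Fin r // j ≠ k} h) _ fun H =>
        hj ((mem_range_labelInclusion h _).1 H ⟨j, hjk⟩)]
      simp

end ExtendOperator

/-! ### Two-party states with an uncorrelated ancilla -/

section Ancilla

set_option linter.unusedSectionVars false

variable {d : ℕ} {k l m : Fin 3}

lemma eq_or_eq_or_eq (hkl : k ≠ l) (hkm : m ≠ k) (hlm : m ≠ l) (j : Fin 3) :
    j = k ∨ j = l ∨ j = m := by
  omega

/-- Splitting the three indices into those of `k`, `l` and that of `m`. -/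
noncomputable def splitEquiv (d : ℕ) (hkl : k ≠ l) (hkm : m ≠ k) (hlm : m ≠ l) :
    (Fin 3 → Fin d) ≃ (Fin 2 → Fin d) × Fin d :=
  Equiv.ofBijective (fun a => (![a k, a l], a m)) <| by
    rw [Fintype.bijective_iff_injective_and_card]
    refine ⟨fun a b h => ?_, by simp [pow_succ]⟩
    simp only [Prod.mk.injEq] at h
    funext j
    rcases eq_or_eq_or_eq hkl hkm hlm j with rfl | rfl | rfl
    · exact congrFun h.1 0
    · exact congrFun h.1 1
    · exact h.2

/-- The three indices as a triple. -/
noncomputable def tripleEquiv (d : ℕ) (hkl : k ≠ l) (hkm : m ≠ k) (hlm : m ≠ l) :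
    (Fin 3 → Fin d) ≃ Fin d × (Fin d × Fin d) :=
  Equiv.ofBijective (fun a => (a k, (a l, a m))) <| by
    rw [Fintype.bijective_iff_injective_and_card]
    refine ⟨fun a b h => ?_, by simp [pow_succ, mul_assoc]⟩
    simp only [Prod.mk.injEq] at h
    funext j
    rcases eq_or_eq_or_eq hkl hkm hlm j with rfl | rfl | rfl
    · exact h.1
    · exact h.2.1
    · exact h.2.2

variable (hkl : k ≠ l) (hkm : m ≠ k) (hlm : m ≠ l)
include hkl hkm hlm

lemma splitEquiv_symm_apply (x : Fin 2 → Fin d) (p : Fin d) :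
    ![(splitEquiv d hkl hkm hlm).symm (x, p) k, (splitEquiv d hkl hkm hlm).symm (x, p) l] = x ∧
      (splitEquiv d hkl hkm hlm).symm (x, p) m = p := by
  have hx := (splitEquiv d hkl hkm hlm).apply_symm_apply (x, p)
  exact ⟨congrArg Prod.fst hx, congrArg Prod.snd hx⟩

lemma withAncilla_eq (ω : Operator 2 d) (α : Matrix (Fin d) (Fin d) ℂ) :
    withAncilla k l m ω α
      = (ω ⊗ₖ α).submatrix (splitEquiv d hkl hkm hlm) (splitEquiv d hkl hkm hlm) := rfl

lemma traceNorm_withAncilla (ω : Operator 2 d) (α : Matrix (Fin d) (Fin d) ℂ) :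
    traceNorm (withAncilla k l m ω α) = traceNorm ω * traceNorm α := by
  rw [withAncilla_eq hkl hkm hlm, traceNorm_eq_rectTraceNorm, rectTraceNorm_submatrix,
    rectTraceNorm_kronecker]
  rfl

lemma posSemidef_withAncilla {ω : Operator 2 d} {α : Matrix (Fin d) (Fin d) ℂ}
    (hω : ω.PosSemidef) (hα : α.PosSemidef) : (withAncilla k l m ω α).PosSemidef := by
  rw [withAncilla_eq hkl hkm hlm]
  exact (hω.kronecker hα).submatrix _

lemma isState_withAncilla {ω : Operator 2 d} {α : Matrix (Fin d) (Fin d) ℂ}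
    (hω : IsState ω) (hα : IsState α) : IsState (withAncilla k l m ω α) := by
  refine ⟨posSemidef_withAncilla hkl hkm hlm hω.1 hα.1, ?_⟩
  have ht : (ω ⊗ₖ α).trace = 1 := by rw [trace_kronecker, hω.2, hα.2, one_mul]
  rw [withAncilla_eq hkl hkm hlm, ← ht]
  simp only [trace, diag_apply, submatrix_apply]
  exact Equiv.sum_comp (splitEquiv d hkl hkm hlm) fun i => (ω ⊗ₖ α) i i

lemma permMap_partialTranspose_left_withAncilla (ω : Operator 2 d)
    (α : Matrix (Fin d) (Fin d) ℂ) :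
    permMap (partialTranspose k) (withAncilla k l m ω α)
      = withAncilla k l m (permMap (partialTranspose 0) ω) α := by
  ext a b
  simp only [withAncilla, permMap_partialTranspose_apply, of_apply, Function.update_self,
    Function.update_of_ne hkl.symm, Function.update_of_ne hkm]
  congr 2 <;> (funext i; fin_cases i <;> simp)

lemma permMap_partialTranspose_right_withAncilla (ω : Operator 2 d)
    (α : Matrix (Fin d) (Fin d) ℂ) :
    permMap (partialTranspose l) (withAncilla k l m ω α)
      = withAncilla k l m (permMap (partialTranspose 1) ω) α := by
  ext a b
  simp only [withAncilla, permMap_partialTranspose_apply, of_apply, Function.update_self,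
    Function.update_of_ne hkl, Function.update_of_ne hlm]
  congr 2 <;> (funext i; fin_cases i <;> simp)

lemma permMap_partialTranspose_ancilla_withAncilla (ω : Operator 2 d)
    (α : Matrix (Fin d) (Fin d) ℂ) :
    permMap (partialTranspose m) (withAncilla k l m ω α) = withAncilla k l m ω αᵀ := by
  ext a b
  simp only [withAncilla, permMap_partialTranspose_apply, of_apply, Function.update_self,
    Function.update_of_ne hkm.symm, Function.update_of_ne hlm.symm, transpose_apply]

lemma permMap_realignment_withAncilla (ω : Operator 2 d) (α : Matrix (Fin d) (Fin d) ℂ) :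
    permMap (realignment k l) (withAncilla k l m ω α)
      = withAncilla k l m (permMap (realignment 0 1) ω) α := by
  ext a b
  simp only [withAncilla, permMap_realignment_apply, of_apply, Function.update_self,
    Function.update_of_ne hkl, Function.update_of_ne hkl.symm, Function.update_of_ne hkm,
    Function.update_of_ne hlm]
  congr 2 <;> (funext i; fin_cases i <;> simp)

section Purity

variable {ω : Operator 2 d} (hω : ω.IsHermitian) {c : ℝ} (hc : 0 ≤ c)

omit hkl hkm hlm in
lemma rectTraceNorm_kronecker_row (M : Matrix (Fin 3 → Fin d) (Fin d) ℂ)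
    (h : Mᴴ * M = (c : ℂ) • 1) (hc : 0 ≤ c) (α : Matrix (Fin d) (Fin d) ℂ) :
    rectTraceNorm (M ⊗ₖ (Matrix.of fun (_ : Unit) (p : Fin d × Fin d) => α p.1 p.2))
      = d * √c * √(∑ p : Fin d × Fin d, ‖α p.1 p.2‖ ^ 2) := by
  rw [rectTraceNorm_kronecker, rectTraceNorm_row (m := Unit),
    rectTraceNorm_eq_of_conjTranspose_mul hc h]
  simp

omit hkl hkm hlm in
lemma rectTraceNorm_kronecker_col (M : Matrix (Fin d) (Fin 3 → Fin d) ℂ)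
    (h : M * Mᴴ = (c : ℂ) • 1) (hc : 0 ≤ c) (α : Matrix (Fin d) (Fin d) ℂ) :
    rectTraceNorm (M ⊗ₖ (Matrix.of fun (p : Fin d × Fin d) (_ : Unit) => α p.1 p.2))
      = d * √c * √(∑ p : Fin d × Fin d, ‖α p.1 p.2‖ ^ 2) := by
  rw [rectTraceNorm_kronecker, rectTraceNorm_col (n := Unit),
    rectTraceNorm_eq_of_mul_conjTranspose hc h]
  simp

include hω hc

/-- The realigned matrix is `M` tensored with `α` as one row: the index of `m` enters `ω`, and the
column index of `k` enters `α`. Then `M† M` is the partial trace of `ω²` over `k`. The next three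
lemmas are the variants with `l` for `k` and with the realignment reversed, where `α` becomes a
column. -/
lemma traceNorm_permMap_realignment_left_ancilla
    (h : ∀ q q', ∑ p, (ω * ω) ![p, q] ![p, q'] = if q = q' then (c : ℂ) else 0)
    (α : Matrix (Fin d) (Fin d) ℂ) :
    traceNorm (permMap (realignment k m) (withAncilla k l m ω α))
      = d * √c * √(∑ p : Fin d × Fin d, ‖α p.1 p.2‖ ^ 2) := by
  let M : Matrix (Fin 3 → Fin d) (Fin d) ℂ := Matrix.of fun a q => ω ![a k, a l] ![a m, q]
  rw [← rectTraceNorm_kronecker_row M ?_ hc,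
    ← rectTraceNorm_submatrix _ (Equiv.prodPUnit _).symm (tripleEquiv d hkl.symm hlm hkm)]
  · rw [traceNorm_eq_rectTraceNorm]
    congr 1
    ext a b
    simp only [withAncilla, permMap_realignment_apply, of_apply, Function.update_self,
      Function.update_of_ne hkl.symm, Function.update_of_ne hkm, Function.update_of_ne hkm.symm,
      Function.update_of_ne hlm.symm]
    rfl
  · ext q q'
    rw [mul_apply, ← Equiv.sum_comp (splitEquiv d hkl hkm hlm).symm, Fintype.sum_prod_type_right,
      Matrix.smul_apply, one_apply, smul_ite, smul_zero, smul_eq_mul, mul_one, ← h]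
    refine Finset.sum_congr rfl fun p _ => ?_
    rw [mul_apply]
    refine Finset.sum_congr rfl fun x _ => ?_
    have hx := splitEquiv_symm_apply hkl hkm hlm x p
    simp only [M, conjTranspose_apply, of_apply, hx.1, hx.2]
    -- Hermiticity removes the conjugation, so the sum over `x` is an entry of `ω * ω`.
    rw [← hω.apply, star_star]

lemma traceNorm_permMap_realignment_ancilla_left
    (h : ∀ q q', ∑ p, (ω * ω) ![p, q] ![p, q'] = if q = q' then (c : ℂ) else 0)
    (α : Matrix (Fin d) (Fin d) ℂ) :
    traceNorm (permMap (realignment m k) (withAncilla k l m ω α))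
      = d * √c * √(∑ p : Fin d × Fin d, ‖α p.1 p.2‖ ^ 2) := by
  let M : Matrix (Fin d) (Fin 3 → Fin d) ℂ := Matrix.of fun q b => ω ![b m, q] ![b k, b l]
  rw [← rectTraceNorm_kronecker_col M ?_ hc,
    ← rectTraceNorm_submatrix _ (tripleEquiv d hlm.symm hkl hkm.symm) (Equiv.prodPUnit _).symm]
  · rw [traceNorm_eq_rectTraceNorm]
    congr 1
    ext a b
    simp only [withAncilla, permMap_realignment_apply, of_apply, Function.update_self,
      Function.update_of_ne hkl.symm, Function.update_of_ne hkm, Function.update_of_ne hkm.symm,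
      Function.update_of_ne hlm.symm]
    rfl
  · ext q q'
    rw [mul_apply, ← Equiv.sum_comp (splitEquiv d hkl hkm hlm).symm, Fintype.sum_prod_type_right,
      Matrix.smul_apply, one_apply, smul_ite, smul_zero, smul_eq_mul, mul_one, ← h]
    refine Finset.sum_congr rfl fun p _ => ?_
    rw [mul_apply]
    refine Finset.sum_congr rfl fun x _ => ?_
    have hx := splitEquiv_symm_apply hkl hkm hlm x p
    simp only [M, conjTranspose_apply, of_apply, hx.1, hx.2]
    rw [hω.apply]

lemma traceNorm_permMap_realignment_right_ancilla
    (h : ∀ q q', ∑ p, (ω * ω) ![q, p] ![q', p] = if q = q' then (c : ℂ) else 0)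
    (α : Matrix (Fin d) (Fin d) ℂ) :
    traceNorm (permMap (realignment l m) (withAncilla k l m ω α))
      = d * √c * √(∑ p : Fin d × Fin d, ‖α p.1 p.2‖ ^ 2) := by
  let M : Matrix (Fin 3 → Fin d) (Fin d) ℂ := Matrix.of fun a q => ω ![a k, a l] ![q, a m]
  rw [← rectTraceNorm_kronecker_row M ?_ hc,
    ← rectTraceNorm_submatrix _ (Equiv.prodPUnit _).symm (tripleEquiv d hkl hkm hlm)]
  · rw [traceNorm_eq_rectTraceNorm]
    congr 1
    ext a b
    simp only [withAncilla, permMap_realignment_apply, of_apply, Function.update_self,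
      Function.update_of_ne hkl, Function.update_of_ne hkm.symm, Function.update_of_ne hlm,
      Function.update_of_ne hlm.symm]
    rfl
  · ext q q'
    rw [mul_apply, ← Equiv.sum_comp (splitEquiv d hkl hkm hlm).symm, Fintype.sum_prod_type_right,
      Matrix.smul_apply, one_apply, smul_ite, smul_zero, smul_eq_mul, mul_one, ← h]
    refine Finset.sum_congr rfl fun p _ => ?_
    rw [mul_apply]
    refine Finset.sum_congr rfl fun x _ => ?_
    have hx := splitEquiv_symm_apply hkl hkm hlm x p
    simp only [M, conjTranspose_apply, of_apply, hx.1, hx.2]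
    rw [← hω.apply, star_star]

lemma traceNorm_permMap_realignment_ancilla_right
    (h : ∀ q q', ∑ p, (ω * ω) ![q, p] ![q', p] = if q = q' then (c : ℂ) else 0)
    (α : Matrix (Fin d) (Fin d) ℂ) :
    traceNorm (permMap (realignment m l) (withAncilla k l m ω α))
      = d * √c * √(∑ p : Fin d × Fin d, ‖α p.1 p.2‖ ^ 2) := by
  let M : Matrix (Fin d) (Fin 3 → Fin d) ℂ := Matrix.of fun q b => ω ![q, b m] ![b k, b l]
  rw [← rectTraceNorm_kronecker_col M ?_ hc,
    ← rectTraceNorm_submatrix _ (tripleEquiv d hkm.symm hkl.symm hlm.symm) (Equiv.prodPUnit _).symm]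
  · rw [traceNorm_eq_rectTraceNorm]
    congr 1
    ext a b
    simp only [withAncilla, permMap_realignment_apply, of_apply, Function.update_self,
      Function.update_of_ne hkl, Function.update_of_ne hkm.symm, Function.update_of_ne hlm,
      Function.update_of_ne hlm.symm]
    rfl
  · ext q q'
    rw [mul_apply, ← Equiv.sum_comp (splitEquiv d hkl hkm hlm).symm, Fintype.sum_prod_type_right,
      Matrix.smul_apply, one_apply, smul_ite, smul_zero, smul_eq_mul, mul_one, ← h]
    refine Finset.sum_congr rfl fun p _ => ?_
    rw [mul_apply]
    refine Finset.sum_congr rfl fun x _ => ?_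
    have hx := splitEquiv_symm_apply hkl hkm hlm x p
    simp only [M, conjTranspose_apply, of_apply, hx.1, hx.2]
    rw [hω.apply]

end Purity

end Ancilla

/-! ### Integral certificates for positivity and trace norms -/

section Integral

set_option linter.unusedSectionVars false

variable {m n : Type*} [Fintype m] [DecidableEq m] [Fintype n]

/-- The complex matrix `s M` of a real scalar `s` and an integral matrix `M`. -/
def scaledInt (s : ℝ) (M : Matrix m n ℤ) : Matrix m n ℂ :=
  Matrix.of fun i j => (s : ℂ) * (M i j : ℂ)

lemma scaledInt_apply (s : ℝ) (M : Matrix m n ℤ) (i : m) (j : n) :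
    scaledInt s M i j = (s : ℂ) * (M i j : ℂ) := rfl

lemma conjTranspose_scaledInt (s : ℝ) (M : Matrix m n ℤ) :
    (scaledInt s M)ᴴ = scaledInt s Mᵀ := by
  ext; simp [scaledInt, conjTranspose_apply]

lemma scaledInt_mul {l : Type*} (s t : ℝ) (M : Matrix m n ℤ) (N : Matrix n l ℤ) :
    scaledInt s M * scaledInt t N = scaledInt (s * t) (M * N) := by
  ext i j
  simp only [scaledInt, mul_apply, of_apply]
  push_cast
  rw [Finset.mul_sum]
  exact Finset.sum_congr rfl fun _ _ => by ring

lemma scaledInt_smul (s : ℝ) (t : ℤ) (M : Matrix m n ℤ) :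
    scaledInt s (t • M) = scaledInt (s * t) M := by
  ext; simp [scaledInt]; ring

lemma scaledInt_one (s : ℝ) : scaledInt s (1 : Matrix m m ℤ) = (s : ℂ) • 1 := by
  ext i j; simp [scaledInt, one_apply]

lemma trace_scaledInt (s : ℝ) (M : Matrix m m ℤ) : (scaledInt s M).trace = s * M.trace := by
  simp [scaledInt, trace, Finset.mul_sum]

/-- A nonnegative multiple of an integral matrix is positive semidefinite if a positive multiple of
it is an integral Gram matrix. -/
lemma posSemidef_scaledInt {s : ℝ} (hs : 0 ≤ s) {t : ℤ} (ht : 0 < t) {M : Matrix m m ℤ}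
    {N : Matrix m n ℤ} (h : N * Nᵀ = t • M) : (scaledInt s M).PosSemidef := by
  have ht' : (0 : ℝ) < t := by exact_mod_cast ht
  have : scaledInt s M = ((s / t : ℝ) : ℂ) • (scaledInt 1 N * (scaledInt 1 N)ᴴ) := by
    rw [conjTranspose_scaledInt, scaledInt_mul, h, scaledInt_smul]
    ext i j
    rw [Matrix.smul_apply, smul_eq_mul, scaledInt_apply, scaledInt_apply]
    have : (t : ℂ) ≠ 0 := by exact_mod_cast ht.ne'
    push_cast
    field_simp
  rw [this]
  exact (posSemidef_self_mul_conjTranspose _).smul (by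
    rw [Complex.zero_le_real]; positivity)

lemma rectTraceNorm_scaledInt_of_mul_transpose {s : ℝ} (hs : 0 ≤ s) {M : Matrix m n ℤ}
    (h : M * Mᵀ = 1) : rectTraceNorm (scaledInt s M) = Fintype.card m * s := by
  rw [rectTraceNorm_eq_of_mul_conjTranspose (mul_self_nonneg s), Real.sqrt_mul_self hs]
  rw [conjTranspose_scaledInt, scaledInt_mul, h, scaledInt_one]

end Integral

/-! ### Positive partial transposes and separability -/

section PartialTranspose

variable {r d : ℕ}

lemma trace_permMap_partialTranspose (j : Fin r) (ρ : Operator r d) :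
    (permMap (partialTranspose j) ρ).trace = ρ.trace := by
  simp [trace, permMap_partialTranspose_apply]

lemma not_detects_of_posSemidef {j : Fin r} {ρ : Operator r d} (hρ : IsState ρ)
    (h : (permMap (partialTranspose j) ρ).PosSemidef) : ¬ Detects (partialTranspose j) ρ := by
  have : IsState (permMap (partialTranspose j) ρ) :=
    ⟨h, by rw [trace_permMap_partialTranspose, hρ.2]⟩
  rw [Detects, traceNorm_eq_rectTraceNorm, this.rectTraceNorm_eq_one]
  exact lt_irrefl 1

/-- The partial transpose of a state separable across the corresponding split is positive. -/
lemma SeparableAcross.posSemidef {j : Fin r} {ρ : Operator r d} (h : SeparableAcross j ρ) :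
    (permMap (partialTranspose j) ρ).PosSemidef := by
  obtain ⟨n, p, A, B, hp, -, hA, hB, h⟩ := h
  let e : (Fin r → Fin d) → Fin d × ({i : Fin r // i ≠ j} → Fin d) := fun a => (a j, fun i => a i)
  have : permMap (partialTranspose j) ρ
      = ∑ i, (p i : ℂ) • ((A i)ᵀ ⊗ₖ B i).submatrix e e := by
    ext a b
    rw [permMap_partialTranspose_apply, h, Matrix.sum_apply]
    refine Finset.sum_congr rfl fun i _ => ?_
    have hu : ∀ (a : Fin r → Fin d) x, (fun i : {i : Fin r // i ≠ j} => Function.update a j x i)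
        = fun i : {i : Fin r // i ≠ j} => a i := fun a x => by
      funext i; exact Function.update_of_ne i.2 _ _
    simp [hu, e]
  rw [this]
  exact posSemidef_sum _ fun i _ => (((hA i).1.transpose.kronecker (hB i).1).submatrix e).smul
    (by rw [Complex.zero_le_real]; exact (hp i).le)

end PartialTranspose

/-! ### Index permutations of integral two-party matrices -/

section IntegralBipartite

variable {d : ℕ}

/-- The partial transpose of an integral operator of two parties. -/
def intPartialTranspose (j : Fin 2) (M : Matrix (Fin 2 → Fin d) (Fin 2 → Fin d) ℤ) :
    Matrix (Fin 2 → Fin d) (Fin 2 → Fin d) ℤ := Matrix.of fun a b =>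
  M (Function.update a j (b j)) (Function.update b j (a j))

/-- The realignment of an integral operator of two parties. -/
def intRealignment (M : Matrix (Fin 2 → Fin d) (Fin 2 → Fin d) ℤ) :
    Matrix (Fin 2 → Fin d) (Fin 2 → Fin d) ℤ := Matrix.of fun a b =>
  M (Function.update a 1 (b 0)) (Function.update b 0 (a 1))

lemma permMap_partialTranspose_scaledInt (j : Fin 2) (s : ℝ)
    (M : Matrix (Fin 2 → Fin d) (Fin 2 → Fin d) ℤ) :
    permMap (partialTranspose j) (scaledInt s M : Operator 2 d)
      = scaledInt s (intPartialTranspose j M) := by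
  ext a b
  rw [permMap_partialTranspose_apply]
  rfl

lemma permMap_realignment_scaledInt (s : ℝ) (M : Matrix (Fin 2 → Fin d) (Fin 2 → Fin d) ℤ) :
    permMap (realignment 0 1) (scaledInt s M : Operator 2 d) = scaledInt s (intRealignment M) := by
  ext a b
  rw [permMap_realignment_apply]
  rfl

end IntegralBipartite

/-! ### The chessboard state -/

section Chessboard

/-- Twelve times the chessboard state as an integral matrix. -/
def chessboardInt : Matrix (Fin 2 → Fin 3) (Fin 2 → Fin 3) ℤ := Matrix.of fun a b =>
  (!![1,  0,  1,  0,  0,  0, 1,  0, 0;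
     0,  1,  0,  0,  0, -1, 0, -1, 0;
     1,  0,  2,  0, -1,  0, 0,  0, 0;
     0,  0,  0,  1,  0, -1, 0,  1, 0;
     0,  0, -1,  0,  1,  0, 1,  0, 0;
     0, -1,  0, -1,  0,  2, 0,  0, 0;
     1,  0,  0,  0,  1,  0, 2,  0, 0;
     0, -1,  0,  1,  0,  0, 0,  2, 0;
     0,  0,  0,  0,  0,  0, 0,  0, 0] : Matrix (Fin 9) (Fin 9) ℤ)
    (finProdFinEquiv (a 0, a 1)) (finProdFinEquiv (b 0, b 1))

lemma chessboard_eq : chessboard = scaledInt (1 / 12) chessboardInt := by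
  have h : ∀ i j : Fin 9, chessboardTable i j = (((!![1,  0,  1,  0,  0,  0, 1,  0, 0;
     0,  1,  0,  0,  0, -1, 0, -1, 0;
     1,  0,  2,  0, -1,  0, 0,  0, 0;
     0,  0,  0,  1,  0, -1, 0,  1, 0;
     0,  0, -1,  0,  1,  0, 1,  0, 0;
     0, -1,  0, -1,  0,  2, 0,  0, 0;
     1,  0,  0,  0,  1,  0, 2,  0, 0;
     0, -1,  0,  1,  0,  0, 0,  2, 0;
     0,  0,  0,  0,  0,  0, 0,  0, 0] : Matrix (Fin 9) (Fin 9) ℤ) i j : ℤ) : ℂ) := by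
    intro i j
    fin_cases i <;> fin_cases j <;> simp [chessboardTable]
  ext a b
  rw [chessboard, of_apply, h, scaledInt_apply]
  norm_num [chessboardInt]

/-- One third of this matrix is an orthogonal projection of trace four, so the state is a quarter of
it; the identity also serves as a Gram factorization. -/
lemma chessboardInt_mul : chessboardInt * chessboardIntᵀ = (3 : ℤ) • chessboardInt := by
  decide +kernel

lemma chessboardInt_trace : chessboardInt.trace = 12 := by decide +kernel

lemma chessboard_isState : IsState chessboard := by
  rw [chessboard_eq]
  refine ⟨posSemidef_scaledInt (by norm_num) (by norm_num) chessboardInt_mul, ?_⟩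
  rw [trace_scaledInt, chessboardInt_trace]
  norm_num

lemma chessboardInt_partialTranspose (j : Fin 2) :
    intPartialTranspose j chessboardInt = chessboardInt := by
  revert j
  decide +kernel

lemma permMap_partialTranspose_chessboard (j : Fin 2) :
    permMap (partialTranspose j) chessboard = chessboard := by
  rw [chessboard_eq, permMap_partialTranspose_scaledInt, chessboardInt_partialTranspose]

/-- The square is three times the matrix, whose partial traces are `4 • 1` because both reduced
states are maximally mixed. After division by `144` this gives `c = 1/12`. -/
lemma chessboardInt_reduced_right : ∀ q q' : Fin 3,
    ∑ p, (chessboardInt * chessboardInt) ![p, q] ![p, q'] = if q = q' then 12 else 0 := by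
  decide +kernel

lemma chessboardInt_reduced_left : ∀ q q' : Fin 3,
    ∑ p, (chessboardInt * chessboardInt) ![q, p] ![q', p] = if q = q' then 12 else 0 := by
  decide +kernel

lemma chessboard_reduced_right (q q' : Fin 3) :
    ∑ p, (chessboard * chessboard) ![p, q] ![p, q']
      = if q = q' then ((1 / 12 : ℝ) : ℂ) else 0 := by
  simp only [chessboard_eq, scaledInt_mul, scaledInt_apply]
  rw [← Finset.mul_sum, ← Int.cast_sum, chessboardInt_reduced_right]
  split_ifs <;> norm_num

lemma chessboard_reduced_left (q q' : Fin 3) :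
    ∑ p, (chessboard * chessboard) ![q, p] ![q', p]
      = if q = q' then ((1 / 12 : ℝ) : ℂ) else 0 := by
  simp only [chessboard_eq, scaledInt_mul, scaledInt_apply]
  rw [← Finset.mul_sum, ← Int.cast_sum, chessboardInt_reduced_left]
  split_ifs <;> norm_num

/-- Thirty-six times the modulus of the realigned chessboard state. -/
def chessboardModulus : Matrix (Fin 2 → Fin 3) (Fin 2 → Fin 3) ℤ := Matrix.of fun a b =>
  if a 0 = a 1 ∧ b 0 = b 1 then (if a = b then 8 else 2)
  else if a = b ∨ a = ![b 1, b 0] then 3 else 0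

/-- An integral factor of six times `chessboardModulus`. -/
def chessboardModulusFactor : Matrix (Fin 2 → Fin 3) (Fin 3 × (Fin 2 → Fin 3)) ℤ :=
  Matrix.of fun a p =>
    if p.1 = 0 then (if a = p.2 ∧ a 0 = a 1 then 6 else 0)
    else if p.1 = 1 then (if a 0 = a 1 ∧ p.2 0 = p.2 1 then 2 else 0)
    else if a 0 ≠ a 1 ∧ (a = p.2 ∨ a = ![p.2 1, p.2 0]) then 3 else 0

/-- The factor `9 = (36 / 12)²` compares the two scalings. The modulus splits into `6 + 2J` on the
span of the `|ii⟩`, with `J` the all-ones matrix, and an all-threes block on each pair `|ij⟩, |ji⟩`;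
the three layers of `chessboardModulusFactor` are roots of these summands times six. -/
lemma chessboardModulus_mul_self :
    chessboardModulus * chessboardModulus
      = (9 : ℤ) • (intRealignment chessboardInt * (intRealignment chessboardInt)ᵀ) := by
  decide +kernel

lemma chessboardModulusFactor_mul_transpose :
    chessboardModulusFactor * chessboardModulusFactorᵀ = (6 : ℤ) • chessboardModulus := by
  decide +kernel

lemma chessboardModulus_trace : chessboardModulus.trace = 42 := by decide +kernel

lemma traceNorm_realignment_chessboard :
    traceNorm (permMap (realignment 0 1) chessboard) = 7 / 6 := by
  rw [chessboard_eq, permMap_realignment_scaledInt, traceNorm_eq_rectTraceNorm,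
    rectTraceNorm_eq (P := scaledInt (1 / 36) chessboardModulus)
    (posSemidef_scaledInt (by norm_num) (by norm_num) chessboardModulusFactor_mul_transpose)]
  · rw [trace_scaledInt, chessboardModulus_trace]
    norm_num
  · rw [conjTranspose_scaledInt, scaledInt_mul, scaledInt_mul, chessboardModulus_mul_self,
      scaledInt_smul]
    norm_num

end Chessboard

/-! ### The Bell state -/

section Bell

/-- Twice the projection on the two-qubit Bell state. -/
def bellInt : Matrix (Fin 2 → Fin 2) (Fin 2 → Fin 2) ℤ := Matrix.of fun a b =>
  if a 0 = a 1 ∧ b 0 = b 1 then 1 else 0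

/-- The two-qubit Bell state. -/
noncomputable def bell : Operator 2 2 := scaledInt (1 / 2) bellInt

lemma bellInt_mul : bellInt * bellIntᵀ = (2 : ℤ) • bellInt := by
  decide +kernel

lemma bell_isState : IsState bell := by
  refine ⟨posSemidef_scaledInt (by norm_num) (by norm_num) bellInt_mul, ?_⟩
  have : bellInt.trace = 2 := by decide +kernel
  rw [bell, trace_scaledInt, this]
  norm_num

/-- The partial transpose is half the swap, a unitary on four dimensions; under realignment it is
half the identity instead. -/
lemma traceNorm_partialTranspose_bell (j : Fin 2) :
    traceNorm (permMap (partialTranspose j) bell) = 2 := by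
  rw [bell, permMap_partialTranspose_scaledInt, traceNorm_eq_rectTraceNorm,
    rectTraceNorm_scaledInt_of_mul_transpose (by norm_num)]
  · norm_num
  · revert j
    decide +kernel

lemma traceNorm_realignment_bell : traceNorm (permMap (realignment 0 1) bell) = 2 := by
  rw [bell, permMap_realignment_scaledInt, traceNorm_eq_rectTraceNorm,
    rectTraceNorm_scaledInt_of_mul_transpose (by norm_num)]
  · norm_num
  · decide +kernel

lemma bell_reduced_right (q q' : Fin 2) :
    ∑ p, (bell * bell) ![p, q] ![p, q'] = if q = q' then ((1 / 2 : ℝ) : ℂ) else 0 := by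
  have : ∀ q q' : Fin 2,
      ∑ p, (bellInt * bellInt) ![p, q] ![p, q'] = if q = q' then 2 else 0 := by decide +kernel
  simp only [bell, scaledInt_mul, scaledInt_apply]
  rw [← Finset.mul_sum, ← Int.cast_sum, this]
  split_ifs <;> norm_num

lemma bell_reduced_left (q q' : Fin 2) :
    ∑ p, (bell * bell) ![q, p] ![q', p] = if q = q' then ((1 / 2 : ℝ) : ℂ) else 0 := by
  have : ∀ q q' : Fin 2,
      ∑ p, (bellInt * bellInt) ![q, p] ![q', p] = if q = q' then 2 else 0 := by decide +kernel
  simp only [bell, scaledInt_mul, scaledInt_apply]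
  rw [← Finset.mul_sum, ← Int.cast_sum, this]
  split_ifs <;> norm_num

end Bell

/-- `σ` is a realignment between the ancilla party `m` and one of the parties `k`, `l`. -/
def IsAncillaRealignment (k l m : Fin 3) (σ : Equiv.Perm (Fin (2 * 3))) : Prop :=
  σ = realignment k m ∨ σ = realignment m k ∨ σ = realignment l m ∨ σ = realignment m l

instance (k l m : Fin 3) (σ : Equiv.Perm (Fin (2 * 3))) :
    Decidable (IsAncillaRealignment k l m σ) :=
  inferInstanceAs (Decidable (_ ∨ _ ∨ _ ∨ _))

lemma traceNorm_of_isAncillaRealignment {d : ℕ} {k l m : Fin 3} (hkl : k ≠ l) (hkm : m ≠ k)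
    (hlm : m ≠ l) {ω : Operator 2 d} (hω : ω.IsHermitian) {c : ℝ} (hc : 0 ≤ c)
    (hr : ∀ q q', ∑ p, (ω * ω) ![p, q] ![p, q'] = if q = q' then (c : ℂ) else 0)
    (hl : ∀ q q', ∑ p, (ω * ω) ![q, p] ![q', p] = if q = q' then (c : ℂ) else 0)
    (α : Matrix (Fin d) (Fin d) ℂ) {σ : Equiv.Perm (Fin (2 * 3))}
    (hσ : IsAncillaRealignment k l m σ) :
    traceNorm (permMap σ (withAncilla k l m ω α))
      = d * √c * √(∑ p : Fin d × Fin d, ‖α p.1 p.2‖ ^ 2) := by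
  rcases hσ with rfl | rfl | rfl | rfl
  · exact traceNorm_permMap_realignment_left_ancilla hkl hkm hlm hω hc hr α
  · exact traceNorm_permMap_realignment_ancilla_left hkl hkm hlm hω hc hr α
  · exact traceNorm_permMap_realignment_right_ancilla hkl hkm hlm hω hc hl α
  · exact traceNorm_permMap_realignment_ancilla_right hkl hkm hlm hω hc hl α

/-! ### Chessboard state with ancilla: one realignment detects -/

section ChessboardAncilla

variable {k l m : Fin 3} {α : Matrix (Fin 3) (Fin 3) ℂ} (hkl : k < l) (hkm : m ≠ k) (hlm : m ≠ l)
  (hα : IsState α)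
include hkl hkm hlm hα

lemma chessboard_withAncilla_posSemidef (j : Fin 3) :
    (permMap (partialTranspose j) (withAncilla k l m chessboard α)).PosSemidef := by
  rcases eq_or_eq_or_eq hkl.ne hkm hlm j with rfl | rfl | rfl
  · rw [permMap_partialTranspose_left_withAncilla hkl.ne hkm hlm,
      permMap_partialTranspose_chessboard]
    exact posSemidef_withAncilla hkl.ne hkm hlm chessboard_isState.1 hα.1
  · rw [permMap_partialTranspose_right_withAncilla hkl.ne hkm hlm,
      permMap_partialTranspose_chessboard]
    exact posSemidef_withAncilla hkl.ne hkm hlm chessboard_isState.1 hα.1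
  · rw [permMap_partialTranspose_ancilla_withAncilla hkl.ne hkm hlm]
    exact posSemidef_withAncilla hkl.ne hkm hlm chessboard_isState.1 hα.1.transpose

lemma traceNorm_realignment_chessboard_withAncilla :
    traceNorm (permMap (realignment k l) (withAncilla k l m chessboard α)) = 7 / 6 := by
  rw [permMap_realignment_withAncilla hkl.ne hkm hlm, traceNorm_withAncilla hkl.ne hkm hlm,
    traceNorm_realignment_chessboard, traceNorm_eq_rectTraceNorm α, hα.rectTraceNorm_eq_one,
    mul_one]

lemma chessboard_withAncilla_isState : IsState (withAncilla k l m chessboard α) :=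
  isState_withAncilla hkl.ne hkm hlm chessboard_isState hα

lemma chessboard_withAncilla_detects (c : Fin 6) :
    Detects (threePartyCriterion c) (withAncilla k l m chessboard α) ↔
      threePartyCriterion c = realignment k l := by
  have hc : threePartyCriterion c = realignment k l ∨
      (∃ j, threePartyCriterion c = partialTranspose j) ∨
      IsAncillaRealignment k l m (threePartyCriterion c) := by
    clear hα
    revert k l m c
    decide +kernel
  constructor
  · intro h
    rcases hc with hc | ⟨j, hj⟩ | hc
    · exact hc
    · rw [hj] at h
      exact absurd h (not_detects_of_posSemidef (chessboard_withAncilla_isState hkl hkm hlm hα)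
        (chessboard_withAncilla_posSemidef hkl hkm hlm hα j))
    · rw [Detects, traceNorm_of_isAncillaRealignment hkl.ne hkm hlm
        chessboard_isState.1.isHermitian (by norm_num) chessboard_reduced_right
        chessboard_reduced_left α hc, mul_assoc, ← Real.sqrt_mul (by norm_num)] at h
      -- The norm is three times this root, and purity at most one gives `1/12 ≤ 1/9` under it.
      have h1 : √(1 / 12 * ∑ p : Fin 3 × Fin 3, ‖α p.1 p.2‖ ^ 2) ≤ 1 / 3 := by
        refine Real.sqrt_le_iff.2 ⟨by norm_num, ?_⟩
        have := hα.sum_norm_sq_le_one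
        linarith
      norm_num at h h1
      linarith
  · intro h
    rw [h, Detects, traceNorm_realignment_chessboard_withAncilla hkl hkm hlm hα]
    norm_num

end ChessboardAncilla

/-! ### Bell state with ancilla: pairwise independence -/

section BellAncilla

variable {k l m : Fin 3} {α : Matrix (Fin 2) (Fin 2) ℂ} (hkl : k < l) (hkm : m ≠ k) (hlm : m ≠ l)
  (hα : IsState α)
include hkl hkm hlm hα

lemma bell_withAncilla_detects {σ : Equiv.Perm (Fin (2 * 3))}
    (hσ : σ = partialTranspose k ∨ σ = partialTranspose l ∨ σ = realignment k l) :
    Detects σ (withAncilla k l m bell α) := by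
  rw [Detects]
  have h1 := hα.rectTraceNorm_eq_one
  rw [← traceNorm_eq_rectTraceNorm] at h1
  rcases hσ with rfl | rfl | rfl
  · rw [permMap_partialTranspose_left_withAncilla hkl.ne hkm hlm,
      traceNorm_withAncilla hkl.ne hkm hlm, traceNorm_partialTranspose_bell, h1]
    norm_num
  · rw [permMap_partialTranspose_right_withAncilla hkl.ne hkm hlm,
      traceNorm_withAncilla hkl.ne hkm hlm, traceNorm_partialTranspose_bell, h1]
    norm_num
  · rw [permMap_realignment_withAncilla hkl.ne hkm hlm,
      traceNorm_withAncilla hkl.ne hkm hlm, traceNorm_realignment_bell, h1]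
    norm_num

lemma bell_withAncilla_not_detects :
    ¬ Detects (partialTranspose m) (withAncilla k l m bell α) := by
  refine not_detects_of_posSemidef (isState_withAncilla hkl.ne hkm hlm bell_isState hα) ?_
  rw [permMap_partialTranspose_ancilla_withAncilla hkl.ne hkm hlm]
  exact posSemidef_withAncilla hkl.ne hkm hlm bell_isState.1 hα.1.transpose

omit hα in
-- With `d = 2` and `c = 1/2` the norm is the square root of twice the purity. The maximally mixed
-- ancilla sits exactly at the threshold and is not detected.
lemma bell_withAncilla_detects_iff {σ : Equiv.Perm (Fin (2 * 3))}
    (hσ : IsAncillaRealignment k l m σ) :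
    Detects σ (withAncilla k l m bell α) ↔ 1 / 2 < ∑ p : Fin 2 × Fin 2, ‖α p.1 p.2‖ ^ 2 := by
  rw [Detects, traceNorm_of_isAncillaRealignment hkl.ne hkm hlm bell_isState.1.isHermitian
    (by norm_num) bell_reduced_right bell_reduced_left α hσ, mul_assoc,
    ← Real.sqrt_mul (by norm_num)]
  have h2 : ((2 : ℕ) : ℝ) = √4 := by
    rw [show (4 : ℝ) = 2 ^ 2 by norm_num, Real.sqrt_sq (by norm_num)]; norm_num
  rw [h2, ← Real.sqrt_mul (by norm_num), Real.lt_sqrt (by norm_num)]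
  constructor <;> intro h <;> linarith

end BellAncilla

/-- The pure one-qubit state `|0⟩⟨0|`. -/
def pureQubit : Matrix (Fin 2) (Fin 2) ℂ := !![1, 0; 0, 0]

/-- The maximally mixed one-qubit state. -/
noncomputable def mixedQubit : Matrix (Fin 2) (Fin 2) ℂ := scaledInt (1 / 2) 1

lemma pureQubit_isState : IsState pureQubit := by
  have h : pureQubit = pureQubit * pureQubitᴴ := by
    ext i j
    fin_cases i <;> fin_cases j <;> simp [pureQubit, mul_apply, conjTranspose_apply]
  refine ⟨?_, by simp [pureQubit, trace]⟩
  rw [h]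
  exact posSemidef_self_mul_conjTranspose _

lemma mixedQubit_isState : IsState mixedQubit := by
  refine ⟨posSemidef_scaledInt (N := (1 : Matrix (Fin 2) (Fin 2) ℤ)) (t := 1)
    (by norm_num) (by norm_num) (by simp), ?_⟩
  rw [mixedQubit, trace_scaledInt]
  simp

lemma pureQubit_purity : ∑ p : Fin 2 × Fin 2, ‖pureQubit p.1 p.2‖ ^ 2 = 1 := by
  simp [Fintype.sum_prod_type, pureQubit]

lemma mixedQubit_purity : ∑ p : Fin 2 × Fin 2, ‖mixedQubit p.1 p.2‖ ^ 2 = 1 / 2 := by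
  simp [Fintype.sum_prod_type, mixedQubit, scaledInt_apply]
  norm_num

/-- The first alternative calls for the mixed ancilla, the second for the pure one. The second is
needed when `c` is a realignment and `c'` the partial transpose of one of its two parties. -/
lemma exists_parties_of_ne : ∀ c c' : Fin 6, c ≠ c' → ∃ k l m : Fin 3, (k < l ∧ m ≠ k ∧ m ≠ l) ∧
    (((threePartyCriterion c = partialTranspose k ∨ threePartyCriterion c = partialTranspose l ∨
        threePartyCriterion c = realignment k l) ∧
      (threePartyCriterion c' = partialTranspose m ∨
        IsAncillaRealignment k l m (threePartyCriterion c'))) ∨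
    (IsAncillaRealignment k l m (threePartyCriterion c) ∧
      threePartyCriterion c' = partialTranspose m)) := by
  decide +kernel

/-- Any two of the six criteria are truly independent. -/
theorem exists_detects_not_detects {d : ℕ} (hd : 2 ≤ d) {c c' : Fin 6} (hcc : c ≠ c') :
    ∃ ρ : Operator 3 d, IsState ρ ∧ Detects (threePartyCriterion c) ρ ∧
      ¬ Detects (threePartyCriterion c') ρ := by
  suffices h : ∃ ρ : Operator 3 2, IsState ρ ∧ Detects (threePartyCriterion c) ρ ∧
      ¬ Detects (threePartyCriterion c') ρ by
    obtain ⟨ρ, h1, h2, h3⟩ := h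
    exact ⟨extendOperator hd ρ, h1.extendOperator hd, (detects_extendOperator hd _ _).2 h2,
      fun h => h3 ((detects_extendOperator hd _ _).1 h)⟩
  obtain ⟨k, l, m, ⟨hkl, hkm, hlm⟩, ⟨h, h'⟩ | ⟨h, h'⟩⟩ := exists_parties_of_ne c c' hcc
  · refine ⟨withAncilla k l m bell mixedQubit,
      isState_withAncilla hkl.ne hkm hlm bell_isState mixedQubit_isState,
      bell_withAncilla_detects hkl hkm hlm mixedQubit_isState h, ?_⟩
    rcases h' with h' | h'
    · rw [h']
      exact bell_withAncilla_not_detects hkl hkm hlm mixedQubit_isState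
    · rw [bell_withAncilla_detects_iff hkl hkm hlm h', mixedQubit_purity]
      exact lt_irrefl _
  · refine ⟨withAncilla k l m bell pureQubit,
      isState_withAncilla hkl.ne hkm hlm bell_isState pureQubit_isState, ?_, ?_⟩
    · rw [bell_withAncilla_detects_iff hkl hkm hlm h, pureQubit_purity]
      norm_num
    · rw [h']
      exact bell_withAncilla_not_detects hkl hkm hlm pureQubit_isState

/-! ### Exactly six nontrivial classes -/

section Counting

variable {d : ℕ}

lemma Dependent.detects_iff {r : ℕ} {σ μ : Equiv.Perm (Fin (2 * r))} (h : Dependent d σ μ)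
    {ρ : Operator r d} (hρ : IsState ρ) : Detects σ ρ ↔ Detects μ ρ := by
  rw [Detects, Detects, h ρ hρ]

lemma not_dependent_of_ne (hd : 2 ≤ d) {c c' : Fin 6} (hcc : c ≠ c') :
    ¬ Dependent d (threePartyCriterion c) (threePartyCriterion c') := fun h => by
  obtain ⟨ρ, hρ, h1, h2⟩ := exists_detects_not_detects hd hcc
  exact h2 ((h.detects_iff hρ).1 h1)

lemma not_dependent_one (hd : 2 ≤ d) (c : Fin 6) :
    ¬ Dependent d (threePartyCriterion c) 1 := fun h => by
  -- The choice of `c'` is immaterial: only a state detected by `c` is needed, since the identity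
  -- detects none.
  obtain ⟨c', hc⟩ := exists_ne c
  obtain ⟨ρ, hρ, h1, -⟩ := exists_detects_not_detects hd hc.symm
  rw [h.detects_iff hρ, Detects, permMap_one, traceNorm_eq_rectTraceNorm,
    hρ.rectTraceNorm_eq_one] at h1
  exact lt_irrefl _ h1

lemma Dependent.symm {r : ℕ} {σ μ : Equiv.Perm (Fin (2 * r))} (h : Dependent d σ μ) :
    Dependent d μ σ := fun ρ hρ => (h ρ hρ).symm

lemma Dependent.trans {r : ℕ} {σ μ ν : Equiv.Perm (Fin (2 * r))} (h : Dependent d σ μ)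
    (h' : Dependent d μ ν) : Dependent d σ ν := fun ρ hρ => (h ρ hρ).trans (h' ρ hρ)

lemma exists_dependent_of_not_dependent_one {σ : Equiv.Perm (Fin (2 * 3))}
    (hσ : ¬ Dependent d σ 1) : ∃ c : Fin 6, Dependent d σ (threePartyCriterion c) := by
  obtain ⟨_ | c, hc⟩ := exists_dependent_representative d σ
  · exact absurd hc hσ
  · exact ⟨c, hc⟩

lemma existsUnique_dependent (hd : 2 ≤ d) {σ : Equiv.Perm (Fin (2 * 3))}
    (hσ : ¬ Dependent d σ 1) : ∃! c : Fin 6, Dependent d σ (threePartyCriterion c) := by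
  obtain ⟨c, hc⟩ := exists_dependent_of_not_dependent_one hσ
  refine ⟨c, hc, fun c' hc' => ?_⟩
  by_contra h
  exact not_dependent_of_ne hd h (hc'.symm.trans hc)

lemma card_nontrivial_classes (hd : 2 ≤ d) :
    Nat.card {q : Quotient (dependenceSetoid 3 d) //
      q ≠ Quotient.mk (dependenceSetoid 3 d) 1} = 6 := by
  let f : Fin 6 → {q : Quotient (dependenceSetoid 3 d) //
      q ≠ Quotient.mk (dependenceSetoid 3 d) 1} := fun c =>
    ⟨Quotient.mk _ (threePartyCriterion c), fun h => not_dependent_one hd c (Quotient.exact h)⟩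
  have hf : Function.Bijective f := by
    refine ⟨fun c c' h => ?_, ?_⟩
    · by_contra hcc
      exact not_dependent_of_ne hd hcc (Quotient.exact (congrArg Subtype.val h))
    · rintro ⟨q, hq⟩
      induction q using Quotient.inductionOn with
      | h σ =>
        obtain ⟨c, hc⟩ := exists_dependent_of_not_dependent_one (d := d) (σ := σ)
          fun h => hq (Quotient.sound h)
        exact ⟨c, Subtype.ext (Quotient.sound hc.symm)⟩
  rw [← Nat.card_eq_of_bijective f hf, Nat.card_eq_fintype_card, Fintype.card_fin]

end Counting

/-! ### Building blocks for separable decompositions -/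

section PhaseState

variable {n : Type*} [Fintype n] [DecidableEq n]

/-- The projection on the normalized vector `(|x⟩ + w |y⟩) / √2`, for a phase `w`. -/
noncomputable def phaseState (x y : n) (w : ℂ) : Matrix n n ℂ :=
  (1 / 2 : ℂ) • vecMulVec (fun i => if i = x then 1 else if i = y then w else 0)
    (star fun i => if i = x then 1 else if i = y then w else 0)

lemma phaseState_isState {x y : n} (hxy : x ≠ y) {w : ℂ} (hw : w * star w = 1) :
    IsState (phaseState x y w) := by
  refine ⟨(posSemidef_vecMulVec_self_star _).smul (by
    rw [Complex.le_def]; norm_num), ?_⟩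
  have : ∀ i : n, (if i = x then 1 else if i = y then w else 0) *
      star (if i = x then 1 else if i = y then w else 0)
        = (if i = x then (1 : ℂ) else 0) + if i = y then 1 else 0 := by
    intro i
    by_cases h : i = x
    · subst h; simp [hxy]
    · by_cases h' : i = y
      · subst h'
        simpa [h] using hw
      · simp [h, h']
  rw [phaseState, trace_smul, trace_vecMulVec, dotProduct]
  simp only [Pi.star_apply, this, Finset.sum_add_distrib, Finset.sum_ite_eq', Finset.mem_univ,
    if_true]
  norm_num

/-- The projection on a basis vector. -/
def basisState (x : n) : Matrix n n ℂ := Matrix.of fun i j => if i = x ∧ j = x then 1 else 0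

lemma basisState_isState (x : n) : IsState (basisState x) := by
  have h : basisState x = basisState x * (basisState x)ᴴ := by
    ext i j
    simp only [basisState, mul_apply, of_apply, conjTranspose_apply]
    by_cases hi : i = x <;> by_cases hj : j = x <;> simp [hi, hj]
  refine ⟨?_, by simp [basisState, trace]⟩
  rw [h]
  exact posSemidef_self_mul_conjTranspose _

end PhaseState

/-! ### Entanglement across exactly one split -/

section Split

/-- Six times the three-qubit state that is entangled across the split of party `k` only. -/
def splitInt (k : Fin 3) : Matrix (Fin 3 → Fin 2) (Fin 3 → Fin 2) ℤ := Matrix.of fun a b =>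
  if a = b then (if ∀ j, j ≠ k → a j ≠ a k then 0 else 1)
  else if (∀ j, a j = a k) ∧ ∀ j, b j = b k then 1 else 0

/-- A three-qubit state that is entangled across the split of party `k` only: a mixture of the
Greenberger-Horne-Zeilinger state and basis states. -/
noncomputable def splitState (k : Fin 3) : Operator 3 2 := scaledInt (1 / 6) (splitInt k)

/-- The partial transpose of party `k` of `splitInt k`. -/
def splitIntTranspose (k : Fin 3) : Matrix (Fin 3 → Fin 2) (Fin 3 → Fin 2) ℤ := Matrix.of fun a b =>
  splitInt k (Function.update a k (b k)) (Function.update b k (a k))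

/-- The transposition moves the two GHZ coherences onto the two basis vectors missing from the
diagonal, leaving a permutation matrix. The trace norm of the transposed state is therefore `8/6`.
-/
lemma splitIntTranspose_mul (k : Fin 3) : splitIntTranspose k * (splitIntTranspose k)ᵀ = 1 := by
  revert k
  decide +kernel

lemma detects_splitState (k : Fin 3) : Detects (partialTranspose k) (splitState k) := by
  have h : permMap (partialTranspose k) (splitState k)
      = scaledInt (1 / 6) (splitIntTranspose k) := by
    ext a b
    rw [permMap_partialTranspose_apply]
    rfl
  rw [Detects, h, traceNorm_eq_rectTraceNorm,
    rectTraceNorm_scaledInt_of_mul_transpose (by norm_num) (splitIntTranspose_mul k)]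
  norm_num

/-- An integral factor of `2 * splitInt k`. -/
def splitFactor (k : Fin 3) : Matrix (Fin 3 → Fin 2) (Fin 3 × (Fin 3 → Fin 2)) ℤ :=
  Matrix.of fun a p =>
    if p.1 = 0 then (if (∀ j, a j = a k) ∧ ∀ j, p.2 j = p.2 k then 1 else 0)
    -- Both remaining values of `p.1` give a copy of the diagonal part, which supplies the factor
    -- two that the GHZ block has by itself.
    else if a = p.2 ∧ (¬ ∀ j, a j = a k) ∧ ¬ ∀ j, j ≠ k → a j ≠ a k then 1 else 0

lemma splitFactor_mul_transpose (k : Fin 3) :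
    splitFactor k * (splitFactor k)ᵀ = (2 : ℤ) • splitInt k := by
  revert k
  decide +kernel

lemma splitState_isState (k : Fin 3) : IsState (splitState k) := by
  refine ⟨posSemidef_scaledInt (by norm_num) (by norm_num) (splitFactor_mul_transpose k), ?_⟩
  have : (splitInt k).trace = 6 := by revert k; decide +kernel
  rw [splitState, trace_scaledInt, this]
  norm_num

/-- `splitInt k` in terms of the indices of party `j`, of party `k`, and of the third party. -/
def splitEntry (s x y t z w : Fin 2) : ℤ :=
  if s = t ∧ x = z ∧ y = w then (if s ≠ x ∧ y ≠ x then 0 else 1)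
  else if (s = x ∧ y = x) ∧ t = z ∧ w = z then 1 else 0

lemma splitInt_eq_splitEntry : ∀ j k m : Fin 3, j ≠ k → m ≠ j → m ≠ k →
    splitInt k = Matrix.of fun a b => splitEntry (a j) (a k) (a m) (b j) (b k) (b m) := by
  decide +kernel

set_option maxHeartbeats 1000000 in
-- Averaging `(|0⟩ + u|1⟩) ⊗ (|00⟩ + ū|11⟩)` over phases `u` keeps the coherence between `|000⟩` and
-- `|111⟩`, where `u ū = 1`, together with the diagonal. Fourth roots of unity are used because `u =
-- ±1` would also keep the coherence between `|011⟩` and `|100⟩`, which carries `u²`. The two basis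
-- products fill in the rest of the diagonal.
lemma splitEntry_decomposition (s x y t z w : Fin 2) :
    (1 / 6 : ℂ) * (splitEntry s x y t z w : ℂ) = ∑ i : Fin 6, (1 / 6 : ℂ) *
      ((![phaseState 0 1 1, phaseState 0 1 Complex.I, phaseState 0 1 (-1),
          phaseState 0 1 (-Complex.I), basisState 0, basisState 1] :
          Fin 6 → Matrix (Fin 2) (Fin 2) ℂ) i s t *
        (![phaseState (0, 0) (1, 1) 1, phaseState (0, 0) (1, 1) (-Complex.I),
          phaseState (0, 0) (1, 1) (-1), phaseState (0, 0) (1, 1) Complex.I,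
          basisState (0, 1), basisState (1, 0)] :
          Fin 6 → Matrix (Fin 2 × Fin 2) (Fin 2 × Fin 2) ℂ) i (x, y) (z, w)) := by
  simp only [Fin.sum_univ_six]
  fin_cases s <;> fin_cases x <;> fin_cases y <;> fin_cases t <;> fin_cases z <;> fin_cases w <;>
    simp [splitEntry, phaseState, basisState, vecMulVec_apply] <;> ring_nf <;>
    norm_num [Complex.I_sq]

lemma separableAcross_splitState {j k : Fin 3} (hjk : j ≠ k) :
    SeparableAcross j (splitState k) := by
  obtain ⟨m, hmj, hmk⟩ : ∃ m : Fin 3, m ≠ j ∧ m ≠ k := by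
    revert j k; decide
  let e : ({i : Fin 3 // i ≠ j} → Fin 2) ≃ Fin 2 × Fin 2 :=
    Equiv.ofBijective (fun a => (a ⟨k, hjk.symm⟩, a ⟨m, hmj⟩)) <| by
      rw [Fintype.bijective_iff_injective_and_card]
      refine ⟨fun a b h => ?_, by simp⟩
      simp only [Prod.mk.injEq] at h
      funext ⟨i, hi⟩
      rcases eq_or_eq_or_eq hjk hmj hmk i with rfl | rfl | rfl
      · exact absurd rfl hi
      · exact h.1
      · exact h.2
  have hsub : ∀ {A : Matrix (Fin 2 × Fin 2) (Fin 2 × Fin 2) ℂ}, IsState A →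
      IsState (A.submatrix e e) := fun {A} hA =>
    ⟨hA.1.submatrix e, by
      rw [← hA.2]
      exact Equiv.sum_comp e fun i => A i i⟩
  have h01 : (0 : Fin 2) ≠ 1 := by decide
  have h0011 : ((0, 0) : Fin 2 × Fin 2) ≠ (1, 1) := by decide
  refine ⟨6, fun _ => 1 / 6, ![phaseState 0 1 1, phaseState 0 1 Complex.I, phaseState 0 1 (-1),
    phaseState 0 1 (-Complex.I), basisState 0, basisState 1],
    fun i => ((![phaseState (0, 0) (1, 1) 1, phaseState (0, 0) (1, 1) (-Complex.I),
      phaseState (0, 0) (1, 1) (-1), phaseState (0, 0) (1, 1) Complex.I,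
      basisState (0, 1), basisState (1, 0)] :
      Fin 6 → Matrix (Fin 2 × Fin 2) (Fin 2 × Fin 2) ℂ) i).submatrix e e,
    fun _ => by norm_num, by norm_num, ?_, fun i => hsub ?_, fun a b => ?_⟩
  · intro i
    fin_cases i
    exacts [phaseState_isState h01 (by simp), phaseState_isState h01 (by simp),
      phaseState_isState h01 (by simp), phaseState_isState h01 (by simp),
      basisState_isState _, basisState_isState _]
  · fin_cases i
    exacts [phaseState_isState h0011 (by simp), phaseState_isState h0011 (by simp),
      phaseState_isState h0011 (by simp), phaseState_isState h0011 (by simp),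
      basisState_isState _, basisState_isState _]
  · rw [splitState, scaledInt_apply, splitInt_eq_splitEntry j k m hjk hmj hmk]
    push_cast
    exact splitEntry_decomposition _ _ _ _ _ _

/-- For every party there is a state that is entangled across the split of that party, separable
across the other two, and detected by the partial transpose of that party only. -/
theorem exists_entangled_across_one_split {d : ℕ} (hd : 2 ≤ d) (k : Fin 3) :
    ∃ ρ : Operator 3 d, IsState ρ ∧ ¬ SeparableAcross k ρ ∧
      (∀ j : Fin 3, j ≠ k → SeparableAcross j ρ) ∧ Detects (partialTranspose k) ρ ∧
      ∀ j : Fin 3, j ≠ k → ¬ Detects (partialTranspose j) ρ := by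
  have hstate := (splitState_isState k).extendOperator hd
  have hsep : ∀ j : Fin 3, j ≠ k → SeparableAcross j (extendOperator hd (splitState k)) :=
    fun j hj => (separableAcross_splitState hj).extendOperator hd
  have hdet := (detects_extendOperator hd _ _).2 (detects_splitState k)
  exact ⟨_, hstate, fun h => not_detects_of_posSemidef hstate h.posSemidef hdet, hsep, hdet,
    fun j hj => not_detects_of_posSemidef hstate (hsep j hj).posSemidef⟩

end Split

/-- For local dimension at least three there are states with positive partial transposes that are
detected by one prescribed realignment only. -/
theorem exists_detects_realignment_only {d : ℕ} (hd : 3 ≤ d) {k l : Fin 3} (hkl : k < l) :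
    ∃ ρ : Operator 3 d, IsState ρ ∧
      (∀ j : Fin 3, (permMap (partialTranspose j) ρ).PosSemidef) ∧
      ∀ c : Fin 6, Detects (threePartyCriterion c) ρ ↔
        threePartyCriterion c = realignment k l := by
  obtain ⟨m, hkm, hlm⟩ : ∃ m : Fin 3, m ≠ k ∧ m ≠ l := by
    clear hd; revert k l; decide
  have hα := basisState_isState (0 : Fin 3)
  refine ⟨extendOperator hd (withAncilla k l m chessboard (basisState 0)),
    (chessboard_withAncilla_isState hkl hkm hlm hα).extendOperator hd, fun j => ?_, fun c => ?_⟩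
  · rw [permMap_extendOperator]
    exact posSemidef_extend (chessboard_withAncilla_posSemidef hkl hkm hlm hα j)
  · rw [detects_extendOperator]
    exact chessboard_withAncilla_detects hkl hkm hlm hα c

end PermSep

theorem mainTheorem2 :
    -- Exact count and true independence, for every local dimension at least two.
    (∀ d : ℕ, 2 ≤ d →
      -- there are exactly six classes of criteria besides the trivial one
      Nat.card {q : Quotient (PermSep.dependenceSetoid 3 d) //
          q ≠ Quotient.mk (PermSep.dependenceSetoid 3 d) 1} = 6 ∧
      -- the six listed criteria are nontrivial, and represent every nontrivial class exactly once
      (∀ c : Fin 6, ¬ PermSep.Dependent d (PermSep.threePartyCriterion c) 1) ∧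
      (∀ σ : Equiv.Perm (Fin (2 * 3)), ¬ PermSep.Dependent d σ 1 →
        ∃! c : Fin 6, PermSep.Dependent d σ (PermSep.threePartyCriterion c)) ∧
      -- each of the six detects a state that any given other one does not detect
      (∀ c c' : Fin 6, c ≠ c' → ∃ ρ : PermSep.Operator 3 d, PermSep.IsState ρ ∧
        PermSep.Detects (PermSep.threePartyCriterion c) ρ ∧
        ¬ PermSep.Detects (PermSep.threePartyCriterion c') ρ) ∧
      -- states separable across two splits but not the third, detected by one partial transpose
      (∀ k : Fin 3, ∃ ρ : PermSep.Operator 3 d, PermSep.IsState ρ ∧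
        ¬ PermSep.SeparableAcross k ρ ∧
        (∀ j : Fin 3, j ≠ k → PermSep.SeparableAcross j ρ) ∧
        PermSep.Detects (PermSep.partialTranspose k) ρ ∧
        ∀ j : Fin 3, j ≠ k → ¬ PermSep.Detects (PermSep.partialTranspose j) ρ)) ∧
    -- For local dimension at least three: states with positive partial transposes that are
    -- detected by one prescribed realignment and by none of the other five criteria.
    (∀ d : ℕ, 3 ≤ d → ∀ k l : Fin 3, k < l →
      ∃ ρ : PermSep.Operator 3 d, PermSep.IsState ρ ∧
        (∀ j : Fin 3, (PermSep.permMap (PermSep.partialTranspose j) ρ).PosSemidef) ∧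
        ∀ c : Fin 6, PermSep.Detects (PermSep.threePartyCriterion c) ρ ↔
          PermSep.threePartyCriterion c = PermSep.realignment k l) ∧
    -- The chessboard state.
    (PermSep.IsState PermSep.chessboard ∧
      (∀ j : Fin 2,
        (PermSep.permMap (PermSep.partialTranspose j) PermSep.chessboard).PosSemidef) ∧
      PermSep.traceNorm
        (PermSep.permMap (PermSep.realignment 0 1) PermSep.chessboard) = 7 / 6) ∧
    -- The chessboard state shared by parties `k` and `l`, with any state as ancilla at party `m`.
    (∀ α : Matrix (Fin 3) (Fin 3) ℂ, PermSep.IsState α →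
      ∀ k l m : Fin 3, k < l → m ≠ k → m ≠ l →
        PermSep.IsState (PermSep.withAncilla k l m PermSep.chessboard α) ∧
        (∀ j : Fin 3, (PermSep.permMap (PermSep.partialTranspose j)
          (PermSep.withAncilla k l m PermSep.chessboard α)).PosSemidef) ∧
        PermSep.traceNorm (PermSep.permMap (PermSep.realignment k l)
          (PermSep.withAncilla k l m PermSep.chessboard α)) = 7 / 6 ∧
        ∀ c : Fin 6, PermSep.Detects (PermSep.threePartyCriterion c)
            (PermSep.withAncilla k l m PermSep.chessboard α) ↔
          PermSep.threePartyCriterion c = PermSep.realignment k l) := by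
  refine ⟨fun d hd => ⟨PermSep.card_nontrivial_classes hd, PermSep.not_dependent_one hd,
    fun σ hσ => PermSep.existsUnique_dependent hd hσ,
    fun c c' hcc => PermSep.exists_detects_not_detects hd hcc,
    PermSep.exists_entangled_across_one_split hd⟩,
    fun d hd k l hkl => PermSep.exists_detects_realignment_only hd hkl,
    ⟨PermSep.chessboard_isState, fun j => ?_, PermSep.traceNorm_realignment_chessboard⟩,
    fun α hα k l m hkl hkm hlm => ⟨PermSep.chessboard_withAncilla_isState hkl hkm hlm hα,
      PermSep.chessboard_withAncilla_posSemidef hkl hkm hlm hα,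
      PermSep.traceNorm_realignment_chessboard_withAncilla hkl hkm hlm hα,
      PermSep.chessboard_withAncilla_detects hkl hkm hlm hα⟩⟩
  rw [PermSep.permMap_partialTranspose_chessboard]
  exact PermSep.chessboard_isState.1
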